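/- A \emph{network} consists of a finite set $D$ of dispatchers, a finite set $S$ of servers, a set $E\subset D\times S$ of compatibility relations, rates $\lambda:D\to(0,\infty)$ and $\mu:S\to(0,\infty)$, and a partition $\mathcal S$ of $S$ such that $\mu$ is constant on each block; servers in the same block share one Poisson process of potential departures. For $x\in\mathbb N^S$ let $\mathcal M(d,x)$ be the set of servers with the least number of tasks among those compatible with $d$. The \emph{load balancing process} of the network is the continuous-time Markov chain $\mathbf X$ on $\mathbb N^S$, with right-continuous piecewise constant paths, with the following dynamics: for each $d\in D$ and $w\in\mathcal M(d,x)$, a task from $d$ is added to $w$ at rate $\lambda(d)/|\mathcal M(d,x)|$; for each block $W\in\mathcal S$, at rate equal to the common value of $\mu$ on $W$, one task simultaneously leaves every server of $W$ that is not idle. That is, the transition semigroup is $e^{tA}$, where $A$ is the corresponding (bounded) generator on bounded functions. The initial distribution is arbitrary. Let $\mathbf X_1,\mathbf X_2$ be load balancing processes of networks $(D,S_i,E_i,\lambda_i,\mu_i,\mathcal S_i)$, $i=1,2$. Consider the following transformations of the first network into the second (data not mentioned is unchanged). * Edge simplification: for some $(d,u)\in E_1$ and $v\notin S_1$, $S_2=S_1\cup\{v\}$,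 $E_2=(E_1\setminus\{(d,u)\})\cup\{(d,v)\}$, $\mu_2(v)=\mu_1(u)$, and $v$ joins the block of $u$: $\mathcal S_2=(\mathcal S_1\setminus\{U\})\cup\{U\cup\{v\}\}$, where $u\in U\in\mathcal S_1$. * Arrival rate decrease: $\lambda_2(d)\le\lambda_1(d)$ for all $d\in D$. * Service rate increase: $\mu_2(w)\ge\mu_1(w)$ for all $w\in S_1$. * Server addition: for some $d\in D$ and $u\notin S_1$, $S_2=S_1\cup\{u\}$, $E_2=E_1\cup\{(d,u)\}$, $\mathcal S_2=\mathcal S_1\cup\{\{u\}\}$, with $\mu_2(u)>0$ arbitrary. Assume that $\mathbf X_1(0)$ and $(\mathbf X_2(0,w))_{w\in S_1}$ are identically distributed. 1. If the second network is obtained from the first by the edge simplification that removes $(d,u)$ and incorporates $v$, and $\mathbf X_2(0,u)\ge\mathbf X_2(0,v)$ almost surely, then for all $t\ge0$, $w\in S_1$ and $k\in\mathbb N$, $$P(\mathbf X_1(t,u)\ge k)\ge P(\mathbf X_2(t,v)\ge k)\quad\text{and}\quad P(\mathbf X_1(t,w)\ge k)\ge P(\mathbf X_2(t,w)\ge k).$$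 Moreover, there are load balancing processes $\mathbf Y_1,\mathbf Y_2$ of the two networks on a common probability space, with the same laws (as processes) as $\mathbf X_1,\mathbf X_2$, such that almost surely $\mathbf Y_1(t,u)\ge\mathbf Y_2(t,v)$ and $\mathbf Y_1(t,w)\ge\mathbf Y_2(t,w)$ for all $t\ge0$ and $w\in S_1$. 2. If the second network is obtained from the first by one arrival rate decrease, service rate increase or server addition, then $P(\mathbf X_1(t,w)\ge k)\ge P(\mathbf X_2(t,w)\ge k)$ for all $t\ge0$, $w\in S_1$ and $k\in\mathbb N$; moreover there are $\mathbf Y_1,\mathbf Y_2$ as in 1 such that almost surely $\mathbf Y_1(t,w)\ge\mathbf Y_2(t,w)$ for all $t\ge0$ and $w\in S_1$. 3. If the second network is obtained from the first by sequentially applying any finite number of the four transformations, and $\mathbf X_2(0,w)=0$ almost surely for all $w\in S_2\setminus S_1$, then the conclusions of 2 hold. -/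

import Mathlib

open MeasureTheory ProbabilityTheory Filter Topology
open scoped NNReal ENNReal BoundedContinuousFunction

universe u

/-- A load balancing network `(D, S, E)` with arrival rates, service rates and a partition of the
servers. The finite set of dispatchers is the type `D`; the finite set `S` of servers is a finite
subset of an ambient type `V`. Servers in the same block of the partition have the same potential
departure process (so that they have the same service rate). Values of `serviceRate` outside
`servers` are never used. -/
structure LBNetwork (D : Type*) (V : Type u) [DecidableEq V] where
  servers : Finset V
  edges : Set (D × V)
  edges_subset : ∀ e ∈ edges, e.2 ∈ servers
  arrivalRate : D → ℝ
  arrivalRate_pos : ∀ d, 0 < arrivalRate d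
  serviceRate : V → ℝ
  serviceRate_pos : ∀ w ∈ servers, 0 < serviceRate w
  partition : Finpartition servers
  serviceRate_eq : ∀ W ∈ partition.parts, ∀ w ∈ W, ∀ w' ∈ W, serviceRate w = serviceRate w'

/-- The exponential of a bounded operator. -/
noncomputable def operatorExp {E : Type*} [NormedAddCommGroup E] [NormedSpace ℝ E]
    (A : E →L[ℝ] E) : E →L[ℝ] E :=
  NormedSpace.exp A

namespace LBNetwork

variable {D : Type*} {V : Type u} [DecidableEq V]

/-- A state records the number of tasks at each server. -/
abbrev State (N : LBNetwork D V) : Type u := N.servers → ℕ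

/-- The servers compatible with dispatcher `d`. -/
def nbhd (N : LBNetwork D V) (d : D) : Set N.servers := {w | (d, (w : V)) ∈ N.edges}

open Classical in
/-- The servers with the least number of tasks among those compatible with `d`. -/
noncomputable def minServers (N : LBNetwork D V) (d : D) (x : N.State) : Finset N.servers :=
  Finset.univ.filter fun w => w ∈ N.nbhd d ∧ ∀ w' ∈ N.nbhd d, x w ≤ x w'

/-- The state after a task is assigned to server `w`. -/
def arrive (N : LBNetwork D V) (w : N.servers) (x : N.State) : N.State :=
  Function.update x w (x w + 1)

/-- The state after a simultaneous potential departure from all the servers in `W`: one task leaves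
each server in `W` that is not idle (the subtraction is truncated at zero). -/
def depart (N : LBNetwork D V) (W : Finset V) (x : N.State) : N.State :=
  fun w => if (w : V) ∈ W then x w - 1 else x w

open Classical in
/-- The intensity of the potential departure process shared by the servers in the block `W`, i.e.
the common service rate of these servers. -/
noncomputable def blockRate (N : LBNetwork D V) (W : Finset V) : ℝ :=
  if h : W.Nonempty then N.serviceRate h.choose else 0

theorem blockRate_eq (N : LBNetwork D V) {W : Finset V} (hW : W ∈ N.partition.parts) {w : V}
    (hw : w ∈ W) : N.blockRate W = N.serviceRate w := by
  have h : W.Nonempty := ⟨w, hw⟩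
  rw [blockRate, dif_pos h]
  exact N.serviceRate_eq W hW _ h.choose_spec _ hw

section Dynamics

variable [Fintype D]

/-- The drift `A f (x) = ∑_y A(x, y) (f y - f x)`: tasks arrive at dispatcher `d` with rate `λ(d)` and
are assigned to a uniformly chosen server with the least number of tasks among those compatible with
`d`; each block of the partition has simultaneous potential departures with rate equal to the common
service rate. -/
noncomputable def drift (N : LBNetwork D V) (f : N.State → ℝ) (x : N.State) : ℝ :=
  (∑ d, ∑ w ∈ N.minServers d x,
      N.arrivalRate d / ((N.minServers d x).card : ℝ) * (f (N.arrive w x) - f x)) +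
    ∑ W ∈ N.partition.parts, N.blockRate W * (f (N.depart W x) - f x)

/-- A bound for the operator norm of the drift. -/
noncomputable def driftBound (N : LBNetwork D V) : ℝ :=
  2 * ((∑ d, N.arrivalRate d) + ∑ W ∈ N.partition.parts, |N.blockRate W|)

theorem abs_drift_le (N : LBNetwork D V) (f : N.State →ᵇ ℝ) (x : N.State) :
    ‖N.drift f x‖ ≤ N.driftBound * ‖f‖ := by
  have hf : ∀ y, |f y - f x| ≤ 2 * ‖f‖ := fun y => by
    have h1 := f.norm_coe_le_norm y
    have h2 := f.norm_coe_le_norm x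
    rw [Real.norm_eq_abs] at h1 h2
    have := abs_sub (f y) (f x)
    linarith
  have h1 : |∑ d, ∑ w ∈ N.minServers d x,
      N.arrivalRate d / ((N.minServers d x).card : ℝ) * (f (N.arrive w x) - f x)|
      ≤ ∑ d, N.arrivalRate d * (2 * ‖f‖) := by
    refine (Finset.abs_sum_le_sum_abs _ _).trans (Finset.sum_le_sum fun d _ => ?_)
    have hd := (N.arrivalRate_pos d).le
    refine (Finset.abs_sum_le_sum_abs _ _).trans ?_
    calc _ ≤ ∑ _w ∈ N.minServers d x,
          N.arrivalRate d / ((N.minServers d x).card : ℝ) * (2 * ‖f‖) := by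
          refine Finset.sum_le_sum fun w _ => ?_
          rw [abs_mul, abs_of_nonneg (by positivity)]
          exact mul_le_mul_of_nonneg_left (hf _) (by positivity)
      _ ≤ _ := by
          rw [Finset.sum_const, nsmul_eq_mul]
          rcases Nat.eq_zero_or_pos (N.minServers d x).card with h | h
          · rw [h]; simp; positivity
          · have : ((N.minServers d x).card : ℝ) ≠ 0 := by positivity
            field_simp; rfl
  have h2 : |∑ W ∈ N.partition.parts, N.blockRate W * (f (N.depart W x) - f x)|
      ≤ ∑ W ∈ N.partition.parts, |N.blockRate W| * (2 * ‖f‖) := by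
    refine (Finset.abs_sum_le_sum_abs _ _).trans (Finset.sum_le_sum fun W _ => ?_)
    rw [abs_mul]
    exact mul_le_mul_of_nonneg_left (hf _) (abs_nonneg _)
  rw [Real.norm_eq_abs, drift]
  refine (abs_add_le _ _).trans ((add_le_add h1 h2).trans (le_of_eq ?_))
  rw [← Finset.sum_mul, ← Finset.sum_mul, driftBound]
  ring

/-- The generator, a bounded operator on the space of bounded functions of the (discrete) state. -/
noncomputable def generator (N : LBNetwork D V) : (N.State →ᵇ ℝ) →L[ℝ] (N.State →ᵇ ℝ) :=
  LinearMap.mkContinuous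
    { toFun := fun f => BoundedContinuousFunction.ofNormedAddCommGroupDiscrete (N.drift f)
        (N.driftBound * ‖f‖) (N.abs_drift_le f)
      map_add' := fun f g => by
        ext x
        simp only [BoundedContinuousFunction.coe_ofNormedAddCommGroupDiscrete, drift,
          BoundedContinuousFunction.coe_add, Pi.add_apply, add_sub_add_comm, mul_add,
          Finset.sum_add_distrib]
        ring
      map_smul' := fun c f => by
        ext x
        simp only [BoundedContinuousFunction.coe_ofNormedAddCommGroupDiscrete, drift,
          BoundedContinuousFunction.coe_smul, smul_eq_mul, RingHom.id_apply, ← mul_sub,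
          mul_left_comm _ c, mul_add, Finset.mul_sum] }
    N.driftBound
    (fun f => by
      have h0 : 0 ≤ N.driftBound :=
        mul_nonneg (by norm_num) (add_nonneg
          (Finset.sum_nonneg fun d _ => (N.arrivalRate_pos d).le)
          (Finset.sum_nonneg fun W _ => abs_nonneg _))
      exact (BoundedContinuousFunction.norm_le (mul_nonneg h0 (norm_nonneg f))).2
        (N.abs_drift_le f))

/-- The transition semigroup `e^{tA}` of the continuous-time Markov chain with generator `A`. -/
noncomputable def semigroup (N : LBNetwork D V) (t : ℝ≥0) :
    (N.State →ᵇ ℝ) →L[ℝ] (N.State →ᵇ ℝ) :=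
  operatorExp ((t : ℝ) • N.generator)

/-- `X` is a load balancing process associated with the network `N`: a continuous-time Markov chain
with generator `N.generator`, arbitrary initial distribution, and piecewise constant sample paths
that are right-continuous with left limits (for the discrete topology on the states). -/
structure IsLoadBalancing (N : LBNetwork D V) {Ω : Type*} [MeasurableSpace Ω]
    (P : Measure Ω) (X : ℝ≥0 → Ω → N.State) : Prop where
  measurable : ∀ t, Measurable (X t)
  rightContinuous : ∀ᵐ ω ∂P, ∀ t, ContinuousWithinAt (fun s => X s ω) (Set.Ici t) t
  leftLimits : ∀ᵐ ω ∂P, ∀ t, ∃ l, Tendsto (fun s => X s ω) (𝓝[<] t) (𝓝 l)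
  markov : ∀ (s t : ℝ≥0) (f : N.State →ᵇ ℝ),
    P[fun ω => f (X (s + t) ω) | ⨆ r : Set.Iic s, MeasurableSpace.comap (X r) inferInstance]
      =ᵐ[P] fun ω => N.semigroup t f (X s ω)

/-- There is a coupling of the load balancing processes `X₁` and `X₂`, i.e. load balancing processes
`Y₁` and `Y₂` on a common probability space with the same laws as `X₁` and `X₂`, such that with
probability one `R (Y₁ t) (Y₂ t)` holds at all times `t`. -/
def ExistsCoupling (N₁ N₂ : LBNetwork D V) {Ω₁ Ω₂ : Type*} [MeasurableSpace Ω₁]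
    [MeasurableSpace Ω₂] (P₁ : Measure Ω₁) (P₂ : Measure Ω₂) (X₁ : ℝ≥0 → Ω₁ → N₁.State)
    (X₂ : ℝ≥0 → Ω₂ → N₂.State) (R : N₁.State → N₂.State → Prop) : Prop :=
  ∃ (Ω : Type u) (_ : MeasurableSpace Ω) (Q : Measure Ω) (_ : IsProbabilityMeasure Q)
    (Y₁ : ℝ≥0 → Ω → N₁.State) (Y₂ : ℝ≥0 → Ω → N₂.State),
    N₁.IsLoadBalancing Q Y₁ ∧ N₂.IsLoadBalancing Q Y₂ ∧
    IdentDistrib (fun ω t => Y₁ t ω) (fun ω t => X₁ t ω) Q P₁ ∧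
    IdentDistrib (fun ω t => Y₂ t ω) (fun ω t => X₂ t ω) Q P₂ ∧
    ∀ᵐ ω ∂Q, ∀ t, R (Y₁ t ω) (Y₂ t ω)


end Dynamics

/-- `N₂` is obtained from `N₁` by the edge simplification that removes the edge `(d, u)` and
incorporates the server `v` and the edge `(d, v)`; `v` is given the potential departure process of
`u`, that is, `v` joins the block of `u`. -/
structure EdgeSimplification (N₁ N₂ : LBNetwork D V) (d : D) (u v : V) : Prop where
  mem_edges : (d, u) ∈ N₁.edges
  notMem_servers : v ∉ N₁.servers
  servers_eq : N₂.servers = insert v N₁.servers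
  edges_eq : N₂.edges = (N₁.edges \ {(d, u)}) ∪ {(d, v)}
  parts_eq : N₂.partition.parts =
    (N₁.partition.parts \ {N₁.partition.part u}) ∪ {insert v (N₁.partition.part u)}
  serviceRate_new : N₂.serviceRate v = N₁.serviceRate u
  arrivalRate_eq : ∀ e, N₂.arrivalRate e = N₁.arrivalRate e
  serviceRate_old : ∀ w ∈ N₁.servers, N₂.serviceRate w = N₁.serviceRate w

/-- The arrival rates are decreased for some dispatchers. -/
structure ArrivalRateDecrease (N₁ N₂ : LBNetwork D V) : Prop where
  servers_eq : N₂.servers = N₁.servers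
  edges_eq : N₂.edges = N₁.edges
  parts_eq : N₂.partition.parts = N₁.partition.parts
  arrivalRate_le : ∀ d, N₂.arrivalRate d ≤ N₁.arrivalRate d
  serviceRate_eq : ∀ w ∈ N₁.servers, N₂.serviceRate w = N₁.serviceRate w

/-- The service rates are increased for some servers. -/
structure ServiceRateIncrease (N₁ N₂ : LBNetwork D V) : Prop where
  servers_eq : N₂.servers = N₁.servers
  edges_eq : N₂.edges = N₁.edges
  parts_eq : N₂.partition.parts = N₁.partition.parts
  arrivalRate_eq : ∀ d, N₂.arrivalRate d = N₁.arrivalRate d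
  serviceRate_le : ∀ w ∈ N₁.servers, N₁.serviceRate w ≤ N₂.serviceRate w

/-- A new server `u`, with its own potential departure process, is attached to the dispatcher `d`. -/
structure ServerAddition (N₁ N₂ : LBNetwork D V) (d : D) (u : V) : Prop where
  notMem_servers : u ∉ N₁.servers
  servers_eq : N₂.servers = insert u N₁.servers
  edges_eq : N₂.edges = N₁.edges ∪ {(d, u)}
  parts_eq : N₂.partition.parts = N₁.partition.parts ∪ {{u}}
  arrivalRate_eq : ∀ e, N₂.arrivalRate e = N₁.arrivalRate e
  serviceRate_old : ∀ w ∈ N₁.servers, N₂.serviceRate w = N₁.serviceRate w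

/-- One of the three simple transformations. -/
inductive SimpleTransformation (N₁ N₂ : LBNetwork D V) : Prop
  | arrival (h : ArrivalRateDecrease N₁ N₂)
  | service (h : ServiceRateIncrease N₁ N₂)
  | addition (d : D) (u : V) (h : ServerAddition N₁ N₂ d u)

/-- A single transformation: an edge simplification or one of the simple transformations. -/
inductive Transformation (N₁ N₂ : LBNetwork D V) : Prop
  | edge (d : D) (u v : V) (h : EdgeSimplification N₁ N₂ d u v)
  | simple (h : SimpleTransformation N₁ N₂)

/-- `N₂` is obtained from `N₁` by sequentially applying finitely many transformations. -/
abbrev FiniteComposition (N₁ N₂ : LBNetwork D V) : Prop :=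
  Relation.ReflTransGen Transformation N₁ N₂

theorem EdgeSimplification.mem_servers {N₁ N₂ : LBNetwork D V} {d : D} {u v : V}
    (h : EdgeSimplification N₁ N₂ d u v) : u ∈ N₁.servers := N₁.edges_subset _ h.mem_edges

theorem EdgeSimplification.subset {N₁ N₂ : LBNetwork D V} {d : D} {u v : V}
    (h : EdgeSimplification N₁ N₂ d u v) : N₁.servers ⊆ N₂.servers := by
  rw [h.servers_eq]; exact Finset.subset_insert _ _

theorem EdgeSimplification.new_mem_servers {N₁ N₂ : LBNetwork D V} {d : D} {u v : V}
    (h : EdgeSimplification N₁ N₂ d u v) : v ∈ N₂.servers := by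
  rw [h.servers_eq]; exact Finset.mem_insert_self _ _

theorem SimpleTransformation.subset {N₁ N₂ : LBNetwork D V}
    (h : SimpleTransformation N₁ N₂) : N₁.servers ⊆ N₂.servers := by
  rcases h with h | h | ⟨d, u, h⟩
  · rw [h.servers_eq]
  · rw [h.servers_eq]
  · rw [h.servers_eq]; exact Finset.subset_insert _ _

theorem FiniteComposition.subset {N₁ N₂ : LBNetwork D V}
    (h : FiniteComposition N₁ N₂) : N₁.servers ⊆ N₂.servers := by
  induction h with
  | refl => exact subset_rfl
  | tail _ h ih =>
    rcases h with ⟨d, u, v, h⟩ | h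
    · exact ih.trans h.subset
    · exact ih.trans h.subset

end LBNetwork

/-!
Both processes are realized as functions of one Markov chain on the pairs of states of the two
networks, and this chain never leaves a relation `T` that implies the required order.

The relation is maintained by coupling the jumps. For one transformation, `T` is the coordinatewise
order `Dom ρ`, where `ρ` pairs each server with itself and, for an edge simplification, also `u` with
the new server `v`. For each dispatcher, `ρ` embeds the servers compatible with it in the first
network into those of the second network. Suppose that the first state dominates the second one and
that a task arrives at this dispatcher in both networks. If a server `w₂` that may receive the task
in the second network is paired with a server `w₁` and both have the same number of tasks, then `w₁`
may receive the task in the first network; moreover, all the servers that may receive the task in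
the first network are then paired with servers that may receive it in the second one. Hence the
uniform choices can be coupled so that the order is preserved (`Dominates.coupled_arrivalMean`).
Departures from paired blocks preserve the order, and so do additional arrivals in the first network
and additional departures in the second one (`Dominates.coupled_stepMean`). For a finite sequence of
transformations, the couplings of the jumps are glued along the intermediate networks
(`Coupled.trans`); the intermediate states exist initially because the new servers are idle.

The generators are bounded, so that a coupling of the jumps with a total rate `Λ` gives a random map
`φ` on the set of pairs related by `T` (`exists_isUniformization`), and the chain that applies an
independent copy of `φ` after each of a sequence of independent exponential times with rate `Λ`. That
its two coordinates are load balancing processes (`IsUniformization.isLoadBalancing`) follows from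
first step analysis: conditioning on the first waiting time shows that the transition functions of
the chain and the semigroup `e^{tA}` satisfy the same renewal equation, which has only one bounded
solution, and the Markov property is obtained in the same way. Finally, the initial distribution
determines the law of a load balancing process (`IsLoadBalancing.identDistrib`), so that the
coordinates of the chain have the same laws as the given processes.
-/

/-! ### Couplings of finitely supported measures -/

/-- A coupling of two finitely supported measures, given through their integration functionals
`L₁` and `L₂`: a finitely supported measure `γ` on the product that has these marginals and is
concentrated on the relation `T`. -/
def Coupled {α β : Type*} (T : α → β → Prop) (L₁ : (α → ℝ) → ℝ) (L₂ : (β → ℝ) → ℝ) : Prop :=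
  ∃ γ : α × β →₀ ℝ≥0, (∀ p ∈ γ.support, T p.1 p.2) ∧
    (∀ h, L₁ h = γ.sum fun p c => (c : ℝ) * h p.1) ∧ ∀ h, L₂ h = γ.sum fun p c => (c : ℝ) * h p.2

namespace Coupled

variable {α β δ ι : Type*} {T : α → β → Prop} {L₁ L₁' : (α → ℝ) → ℝ} {L₂ L₂' : (β → ℝ) → ℝ}

theorem congr (h : Coupled T L₁ L₂) (h₁ : ∀ f, L₁' f = L₁ f) (h₂ : ∀ f, L₂' f = L₂ f) :
    Coupled T L₁' L₂' := by
  obtain ⟨γ, hγ, h1, h2⟩ := h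
  exact ⟨γ, hγ, fun f => (h₁ f).trans (h1 f), fun f => (h₂ f).trans (h2 f)⟩

theorem mono {T' : α → β → Prop} (h : Coupled T L₁ L₂) (hT : ∀ a b, T a b → T' a b) :
    Coupled T' L₁ L₂ := by
  obtain ⟨γ, hγ, h12⟩ := h
  exact ⟨γ, fun p hp => hT _ _ (hγ p hp), h12⟩

theorem single {a : α} {b : β} (h : T a b) : Coupled T (fun f => f a) (fun f => f b) := by
  classical
  refine ⟨Finsupp.single (a, b) 1, fun p hp => ?_, fun f => ?_, fun f => ?_⟩
  · have := Finsupp.support_single_subset hp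
    rw [Finset.mem_singleton] at this
    rwa [this]
  · rw [Finsupp.sum_single_index] <;> simp
  · rw [Finsupp.sum_single_index] <;> simp

theorem zero : Coupled T (fun _ => 0) (fun _ => 0) :=
  ⟨0, fun p hp => by simp at hp, fun f => by simp, fun f => by simp⟩

theorem add (h : Coupled T L₁ L₂) (h' : Coupled T L₁' L₂') :
    Coupled T (fun f => L₁ f + L₁' f) (fun f => L₂ f + L₂' f) := by
  classical
  obtain ⟨γ, hγ, h1, h2⟩ := h
  obtain ⟨γ', hγ', h1', h2'⟩ := h'
  refine ⟨γ + γ', fun p hp => ?_, fun f => ?_, fun f => ?_⟩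
  · rcases Finset.mem_union.1 (Finsupp.support_add hp) with hp | hp
    exacts [hγ p hp, hγ' p hp]
  · change _ + _ = _
    rw [h1, h1', Finsupp.sum_add_index']
    · simp
    · intro p c c'; push_cast; ring
  · change _ + _ = _
    rw [h2, h2', Finsupp.sum_add_index']
    · simp
    · intro p c c'; push_cast; ring

theorem smul (h : Coupled T L₁ L₂) {c : ℝ} (hc : 0 ≤ c) :
    Coupled T (fun f => c * L₁ f) (fun f => c * L₂ f) := by
  classical
  obtain ⟨γ, hγ, h1, h2⟩ := h
  lift c to ℝ≥0 using hc
  refine ⟨c • γ, fun p hp => hγ p (Finsupp.support_smul hp), fun f => ?_, fun f => ?_⟩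
  · change _ * _ = _
    rw [h1, Finsupp.sum_smul_index (by simp), Finsupp.mul_sum]
    refine Finsupp.sum_congr fun p _ => ?_
    push_cast; ring
  · change _ * _ = _
    rw [h2, Finsupp.sum_smul_index (by simp), Finsupp.mul_sum]
    refine Finsupp.sum_congr fun p _ => ?_
    push_cast; ring

theorem sum {s : Finset ι} {M₁ : ι → (α → ℝ) → ℝ} {M₂ : ι → (β → ℝ) → ℝ}
    (h : ∀ i ∈ s, Coupled T (M₁ i) (M₂ i)) :
    Coupled T (fun f => ∑ i ∈ s, M₁ i f) (fun f => ∑ i ∈ s, M₂ i f) := by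
  classical
  induction s using Finset.induction_on with
  | empty => simpa using zero
  | insert i s hi ih =>
    simp only [Finset.sum_insert hi]
    exact (h i (Finset.mem_insert_self i s)).add
      (ih fun j hj => h j (Finset.mem_insert_of_mem hj))

theorem symm (h : Coupled T L₁ L₂) : Coupled (fun b a => T a b) L₂ L₁ := by
  obtain ⟨γ, hγ, h1, h2⟩ := h
  refine (sum (s := γ.support) (M₁ := fun p f => (γ p : ℝ) * f p.2)
    (M₂ := fun p f => (γ p : ℝ) * f p.1) fun p hp => ?_).congr h2 h1
  exact (single (T := fun b a => T a b) (hγ p hp)).smul (γ p).2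

/-- Gluing of couplings with a common marginal: conditionally on the middle coordinate, the outer
coordinates are taken to be independent. -/
theorem trans {T' : β → δ → Prop} {L₃ : (δ → ℝ) → ℝ} (h : Coupled T L₁ L₂)
    (h' : Coupled T' L₂ L₃) : Coupled (fun a c => ∃ b, T a b ∧ T' b c) L₁ L₃ := by
  classical
  obtain ⟨γ, hγ, h1, h2⟩ := h
  obtain ⟨γ', hγ', h1', h2'⟩ := h'
  -- `q b` is the mass that the common marginal gives to `b`.
  let q : β → ℝ := fun b => L₂ (Pi.single b 1)
  have hq1 : ∀ b, q b = ∑ p ∈ γ.support, if p.2 = b then (γ p : ℝ) else 0 := fun b => by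
    simp only [q]
    rw [h2]
    refine Finset.sum_congr rfl fun p _ => ?_
    by_cases hp : p.2 = b <;> simp [hp]
  have hq2 : ∀ b, q b = ∑ p ∈ γ'.support, if p.1 = b then (γ' p : ℝ) else 0 := fun b => by
    simp only [q]
    rw [h1']
    refine Finset.sum_congr rfl fun p _ => ?_
    by_cases hp : p.1 = b <;> simp [hp]
  have hq0 : ∀ b, 0 ≤ q b := fun b => by
    rw [hq1]
    exact Finset.sum_nonneg fun p _ => by split_ifs <;> simp
  have hp1 : ∀ p ∈ γ.support, q p.2 ≠ 0 := fun p hp => by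
    have : (γ p : ℝ) ≤ q p.2 := by
      rw [hq1]
      refine le_trans (by simp) (Finset.single_le_sum
        (f := fun p' => if p'.2 = p.2 then (γ p' : ℝ) else 0)
        (fun p' _ => by split_ifs <;> simp) hp)
    have h0 : 0 < (γ p : ℝ) := by
      have := Finsupp.mem_support_iff.1 hp
      positivity
    linarith
  have hp2 : ∀ p ∈ γ'.support, q p.1 ≠ 0 := fun p hp => by
    have : (γ' p : ℝ) ≤ q p.1 := by
      rw [hq2]
      refine le_trans (by simp) (Finset.single_le_sum
        (f := fun p' => if p'.1 = p.1 then (γ' p' : ℝ) else 0)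
        (fun p' _ => by split_ifs <;> simp) hp)
    have h0 : 0 < (γ' p : ℝ) := by
      have := Finsupp.mem_support_iff.1 hp
      positivity
    linarith
  have key := sum (s := γ.support ×ˢ γ'.support) (T := fun a c => ∃ b, T a b ∧ T' b c)
    (M₁ := fun r f => (if r.1.2 = r.2.1 then (γ r.1 : ℝ) * γ' r.2 / q r.1.2 else 0) * f r.1.1)
    (M₂ := fun r f => (if r.1.2 = r.2.1 then (γ r.1 : ℝ) * γ' r.2 / q r.1.2 else 0) * f r.2.2)
    (fun r hr => by
      obtain ⟨hr1, hr2⟩ := Finset.mem_product.1 hr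
      by_cases he : r.1.2 = r.2.1
      · refine (single (a := r.1.1) (b := r.2.2) ⟨r.1.2, hγ _ hr1, he ▸ hγ' _ hr2⟩).smul ?_
        have := hq0 r.1.2
        split_ifs
        positivity
      · simp only [he, if_false, zero_mul]
        exact zero)
  refine key.congr (fun f => ?_) fun f => ?_
  · rw [h1, Finset.sum_product]
    refine Finset.sum_congr rfl fun p hp => ?_
    have : ∀ p' ∈ γ'.support, (if p.2 = p'.1 then (γ p : ℝ) * γ' p' / q p.2 else 0) * f p.1
        = (γ p * f p.1 / q p.2) * (if p'.1 = p.2 then (γ' p' : ℝ) else 0) := fun p' _ => by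
      by_cases he : p'.1 = p.2
      · rw [if_pos he.symm, if_pos he]; ring
      · rw [if_neg (Ne.symm he), if_neg he]; ring
    rw [Finset.sum_congr rfl this, ← Finset.mul_sum, ← hq2]
    have := hp1 p hp
    field_simp
  · rw [h2', Finset.sum_product_right]
    refine Finset.sum_congr rfl fun p hp => ?_
    have : ∀ p' ∈ γ.support, (if p'.2 = p.1 then (γ p' : ℝ) * γ' p / q p'.2 else 0) * f p.2
        = (γ' p * f p.2 / q p.1) * (if p'.2 = p.1 then (γ p' : ℝ) else 0) := fun p' _ => by
      by_cases he : p'.2 = p.1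
      · rw [if_pos he, if_pos he, he]; ring
      · rw [if_neg he, if_neg he]; ring
    rw [Finset.sum_congr rfl this, ← Finset.mul_sum, ← hq1]
    have := hp2 p hp
    field_simp

end Coupled

namespace LBNetwork

variable {D : Type*} {V : Type u} [DecidableEq V]

/-! ### Coupling of one transition -/

open Classical in
/-- The expectation of `h` after a task arrives at dispatcher `d`; the task is lost if no server is
compatible with `d`. -/
noncomputable def arrivalMean (N : LBNetwork D V) (d : D) (x : N.State) (h : N.State → ℝ) : ℝ :=
  if (N.minServers d x).Nonempty then
    ((N.minServers d x).card : ℝ)⁻¹ * ∑ w ∈ N.minServers d x, h (N.arrive w x)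
  else h x

/-- The states that can follow `x` when a task arrives at dispatcher `d`. -/
def ArrivalOutcome (N : LBNetwork D V) (d : D) (x z : N.State) : Prop :=
  z = x ∨ ∃ w ∈ N.minServers d x, z = N.arrive w x

theorem mem_minServers (N : LBNetwork D V) {d : D} {x : N.State} {w : N.servers} :
    w ∈ N.minServers d x ↔ w ∈ N.nbhd d ∧ ∀ w' ∈ N.nbhd d, x w ≤ x w' := by
  simp [minServers]

theorem le_arrive (N : LBNetwork D V) (w : N.servers) (x : N.State) : x ≤ N.arrive w x := by
  intro w'
  rw [arrive, Function.update_apply]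
  split_ifs with h
  · rw [h]; exact Nat.le_succ _
  · exact le_rfl

theorem ArrivalOutcome.le {N : LBNetwork D V} {d : D} {x z : N.State}
    (h : N.ArrivalOutcome d x z) : x ≤ z := by
  rcases h with rfl | ⟨w, -, rfl⟩
  exacts [le_rfl, N.le_arrive w x]

theorem coupled_arrivalMean_unit (N : LBNetwork D V) (d : D) (x : N.State) :
    Coupled (fun z (_ : Unit) => N.ArrivalOutcome d x z) (N.arrivalMean d x) (fun f => f ()) := by
  by_cases h : (N.minServers d x).Nonempty
  · have hc : ((N.minServers d x).card : ℝ) ≠ 0 := by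
      have := h.card_pos
      positivity
    refine ((Coupled.sum (s := N.minServers d x) (M₁ := fun w f => f (N.arrive w x))
      (M₂ := fun _ f => f ()) fun w hw => Coupled.single (Or.inr ⟨w, hw, rfl⟩)).smul
      (c := ((N.minServers d x).card : ℝ)⁻¹) (by positivity)).congr (fun f => ?_) fun f => ?_
    · rw [arrivalMean, if_pos h]
    · rw [Finset.sum_const, nsmul_eq_mul, inv_mul_cancel_left₀ hc]
  · refine (Coupled.single (T := fun z (_ : Unit) => N.ArrivalOutcome d x z) (a := x) (b := ())
      (Or.inl rfl)).congr (fun f => ?_) fun f => rfl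
    rw [arrivalMean, if_neg h]

/-- The coordinatewise order between the states of two networks, when the servers are paired by the
relation `ρ`. -/
def Dom {N₁ N₂ : LBNetwork D V} (ρ : N₁.servers → N₂.servers → Prop) (x : N₁.State)
    (y : N₂.State) : Prop :=
  ∀ w₁ w₂, ρ w₁ w₂ → y w₂ ≤ x w₁

/-- The properties shared by the elementary transformations. Servers are paired by `ρ`, in such a
way that, for each dispatcher, `ρ` embeds the compatible servers of `N₁` into those of `N₂`; and
blocks are mapped by `b`. -/
structure Dominates (N₁ N₂ : LBNetwork D V) (ρ : N₁.servers → N₂.servers → Prop)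
    (b : Finset V → Finset V) : Prop where
  arrivalRate_le : ∀ d, N₂.arrivalRate d ≤ N₁.arrivalRate d
  exists_nbhd : ∀ d, ∀ w₁ ∈ N₁.nbhd d, ∃ w₂ ∈ N₂.nbhd d, ρ w₁ w₂
  mem_nbhd : ∀ d, ∀ w₂ ∈ N₂.nbhd d, ∀ w₁, ρ w₁ w₂ → w₁ ∈ N₁.nbhd d
  right_unique : ∀ d, ∀ w₂ ∈ N₂.nbhd d, ∀ w₂' ∈ N₂.nbhd d, ∀ w₁, ρ w₁ w₂ → ρ w₁ w₂' → w₂ = w₂'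
  left_unique : ∀ w₁ w₁' w₂, ρ w₁ w₂ → ρ w₁' w₂ → w₁ = w₁'
  block_mem : ∀ W ∈ N₁.partition.parts, b W ∈ N₂.partition.parts
  block_injOn : Set.InjOn b N₁.partition.parts
  blockRate_le : ∀ W ∈ N₁.partition.parts, N₁.blockRate W ≤ N₂.blockRate (b W)
  mem_block : ∀ W ∈ N₁.partition.parts, ∀ (w₁ : N₁.servers) (w₂ : N₂.servers),
    ρ w₁ w₂ → (w₁ : V) ∈ W → (w₂ : V) ∈ b W

theorem blockRate_pos (N : LBNetwork D V) {W : Finset V} (hW : W ∈ N.partition.parts) :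
    0 < N.blockRate W := by
  obtain ⟨w, hw⟩ := N.partition.nonempty_of_mem_parts hW
  rw [N.blockRate_eq hW hw]
  exact N.serviceRate_pos w (N.partition.le hW hw)

section Step

variable {N₁ N₂ : LBNetwork D V} {ρ : N₁.servers → N₂.servers → Prop} {b : Finset V → Finset V}

theorem Dom.arrive_right {x : N₁.State} {y : N₂.State} {w₂ : N₂.servers} (h : Dom ρ x y)
    (hw : ∀ w₁, ρ w₁ w₂ → y w₂ < x w₁) : Dom ρ x (N₂.arrive w₂ y) := by
  intro a c hac
  rw [arrive, Function.update_apply]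
  split_ifs with hc
  · subst hc
    exact hw a hac
  · exact h a c hac

theorem Dom.mono_left {x z : N₁.State} {y : N₂.State} (h : Dom ρ x y) (hz : x ≤ z) : Dom ρ z y :=
  fun a c hac => (h a c hac).trans (hz a)

theorem Dom.arrive_both (H : Dominates N₁ N₂ ρ b) {x : N₁.State} {y : N₂.State}
    {w₁ : N₁.servers} {w₂ : N₂.servers} (h : Dom ρ x y) (hw : ρ w₁ w₂) :
    Dom ρ (N₁.arrive w₁ x) (N₂.arrive w₂ y) := by
  intro a c hac
  have hx := (N₁.le_arrive w₁ x) a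
  by_cases hc : c = w₂
  · subst hc
    obtain rfl := H.left_unique _ _ _ hac hw
    have := h a c hac
    simpa [arrive] using this
  · have : N₂.arrive w₂ y c = y c := by simp [arrive, hc]
    rw [this]
    exact (h a c hac).trans hx

theorem Dom.depart_both (H : Dominates N₁ N₂ ρ b) {x : N₁.State} {y : N₂.State} {W : Finset V}
    (hW : W ∈ N₁.partition.parts) (h : Dom ρ x y) :
    Dom ρ (N₁.depart W x) (N₂.depart (b W) y) := by
  intro a c hac
  have h1 := h a c hac
  have h2 := H.mem_block W hW a c hac
  simp only [depart]
  split_ifs with h3 h4 h4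
  · omega
  · omega
  · exact absurd (h2 h4) h3
  · exact h1

theorem Dom.depart_right {x : N₁.State} {y : N₂.State} (W : Finset V) (h : Dom ρ x y) :
    Dom ρ x (N₂.depart W y) := by
  intro a c hac
  have h1 := h a c hac
  simp only [depart]
  split_ifs <;> omega

/-- If the state of `N₁` dominates the state of `N₂`, then simultaneous arrivals at a dispatcher can
be coupled so that this remains true. A server `w₂` of `N₂` with the least number of tasks can only
be a problem if it is paired with a server of `N₁` that has the same number of tasks; then the
latter also has the least number of tasks, and the task of `N₁` is assigned to it. -/
theorem Dominates.coupled_arrivalMean (H : Dominates N₁ N₂ ρ b) (d : D) {x : N₁.State}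
    {y : N₂.State} (h : Dom ρ x y) :
    Coupled (Dom ρ) (N₁.arrivalMean d x) (N₂.arrivalMean d y) := by
  classical
  by_cases hfree : ∀ w₂ ∈ N₂.minServers d y, ∀ w₁, ρ w₁ w₂ → y w₂ < x w₁
  · refine ((N₁.coupled_arrivalMean_unit d x).trans (N₂.coupled_arrivalMean_unit d y).symm).mono ?_
    rintro z z' ⟨-, hz, hz'⟩
    refine Dom.mono_left ?_ hz.le
    rcases hz' with rfl | ⟨w₂, hw₂, rfl⟩
    exacts [h, h.arrive_right (hfree w₂ hw₂)]
  push Not at hfree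
  obtain ⟨c, hc, a, hac, hxy⟩ := hfree
  rw [mem_minServers] at hc
  have hy_le : ∀ w₁ ∈ N₁.nbhd d, y c ≤ x w₁ := fun w₁ hw₁ => by
    obtain ⟨w₂, hw₂, hρ⟩ := H.exists_nbhd d w₁ hw₁
    exact (hc.2 w₂ hw₂).trans (h _ _ hρ)
  have hmin : ∀ w₁, w₁ ∈ N₁.minServers d x ↔ w₁ ∈ N₁.nbhd d ∧ x w₁ ≤ y c := fun w₁ => by
    rw [mem_minServers]
    refine and_congr_right fun hw₁ => ⟨fun h' => ?_, fun h' w' hw' => h'.trans (hy_le w' hw')⟩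
    exact (h' a (H.mem_nbhd d c hc.1 a hac)).trans hxy
  have ha : a ∈ N₁.minServers d x := (hmin a).2 ⟨H.mem_nbhd d c hc.1 a hac, hxy⟩
  have hex : ∀ w₁ : N₁.servers, ∃ w₂, w₁ ∈ N₁.minServers d x →
      w₂ ∈ N₂.minServers d y ∧ ρ w₁ w₂ := fun w₁ => by
    by_cases hw₁ : w₁ ∈ N₁.minServers d x
    · obtain ⟨w₂, hw₂, hρ⟩ := H.exists_nbhd d w₁ ((hmin w₁).1 hw₁).1
      refine ⟨w₂, fun _ => ⟨?_, hρ⟩⟩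
      rw [mem_minServers]
      refine ⟨hw₂, fun w' hw' => ?_⟩
      exact ((h _ _ hρ).trans ((hmin w₁).1 hw₁).2).trans (hc.2 w' hw')
    · exact ⟨c, fun h' => absurd h' hw₁⟩
  choose i hi using hex
  have hinj : Set.InjOn i (N₁.minServers d x) := fun w hw w' hw' he =>
    H.left_unique _ _ _ (hi w hw).2 (he ▸ (hi w' hw').2)
  set M₁ := N₁.minServers d x
  set M₂ := N₂.minServers d y
  have hsub : M₁.image i ⊆ M₂ := fun w hw => by
    obtain ⟨w₁, hw₁, rfl⟩ := Finset.mem_image.1 hw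
    exact (hi w₁ hw₁).1
  have hne₁ : M₁.Nonempty := ⟨a, ha⟩
  have hne₂ : M₂.Nonempty := ⟨i a, (hi a ha).1⟩
  have hc₁ : (M₁.card : ℝ) ≠ 0 := by
    have := hne₁.card_pos
    positivity
  have hc₂ : (M₂.card : ℝ) ≠ 0 := by
    have := hne₂.card_pos
    positivity
  -- Servers of `N₂` that are not paired with a server in `M₁`.
  have hrest : ∀ w₂ ∈ M₂ \ M₁.image i,
      Coupled (Dom ρ) (N₁.arrivalMean d x) (fun f => f (N₂.arrive w₂ y)) := fun w₂ hw₂ => by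
    obtain ⟨hw₂, hni⟩ := Finset.mem_sdiff.1 hw₂
    refine ((N₁.coupled_arrivalMean_unit d x).trans (Coupled.single
      (T := fun (_ : Unit) z => z = N₂.arrive w₂ y) (a := ()) rfl)).mono ?_
    rintro z z' ⟨-, hz, rfl⟩
    refine (h.arrive_right fun w₁ hρ => ?_).mono_left hz.le
    by_contra! hle
    have hw₂' := N₂.mem_minServers.1 hw₂
    have hw₁ : w₁ ∈ M₁ :=
      (hmin w₁).2 ⟨H.mem_nbhd d w₂ hw₂'.1 w₁ hρ, hle.trans (hw₂'.2 c hc.1)⟩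
    have := H.right_unique d w₂ hw₂'.1 (i w₁) (N₂.mem_minServers.1 (hi w₁ hw₁).1).1 w₁ hρ
      (hi w₁ hw₁).2
    exact hni (this ▸ Finset.mem_image_of_mem i hw₁)
  refine (((Coupled.sum (s := M₁) fun w₁ hw₁ =>
    Coupled.single (h.arrive_both H (hi w₁ hw₁).2)).add (Coupled.sum hrest)).smul
      (c := (M₂.card : ℝ)⁻¹) (by positivity)).congr (fun f => ?_) fun f => ?_
  · rw [Finset.sum_const, nsmul_eq_mul, Finset.card_sdiff_of_subset hsub,
      Finset.card_image_of_injOn hinj, Nat.cast_sub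
        ((Finset.card_image_of_injOn hinj).symm.le.trans (Finset.card_le_card hsub)),
      arrivalMean, if_pos hne₁]
    field_simp
    ring
  · rw [arrivalMean, if_pos hne₂, ← Finset.sum_sdiff hsub, Finset.sum_image hinj, add_comm]

variable [Fintype D]

/-- The integral of `h` with respect to the measure with total mass `Λ` that describes the jumps
from `x`, including void jumps. Divided by `Λ`, it is the expectation of `h` after one step of the
uniformized chain. -/
noncomputable def stepMean (N : LBNetwork D V) (Λ : ℝ) (x : N.State) (h : N.State → ℝ) : ℝ :=
  N.drift h x + Λ * h x

theorem drift_eq (N : LBNetwork D V) (h : N.State → ℝ) (x : N.State) :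
    N.drift h x = ∑ d, N.arrivalRate d * (N.arrivalMean d x h - h x) +
      ∑ W ∈ N.partition.parts, N.blockRate W * (h (N.depart W x) - h x) := by
  rw [drift]
  congr 1
  refine Finset.sum_congr rfl fun d _ => ?_
  rw [← Finset.mul_sum, Finset.sum_sub_distrib, Finset.sum_const, nsmul_eq_mul, arrivalMean]
  split_ifs with hM
  · have : ((N.minServers d x).card : ℝ) ≠ 0 := by
      have := hM.card_pos
      positivity
    field_simp
  · rw [Finset.not_nonempty_iff_eq_empty] at hM
    simp [hM]

theorem Dominates.coupled_stepMean (H : Dominates N₁ N₂ ρ b) {Λ : ℝ}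
    (hΛ : (∑ d, N₁.arrivalRate d) + ∑ W ∈ N₂.partition.parts, N₂.blockRate W ≤ Λ)
    {x : N₁.State} {y : N₂.State} (h : Dom ρ x y) :
    Coupled (Dom ρ) (N₁.stepMean Λ x) (N₂.stepMean Λ y) := by
  classical
  set p₁ := N₁.partition.parts
  set p₂ := N₂.partition.parts
  have hsub : p₁.image b ⊆ p₂ := fun W hW => by
    obtain ⟨W', hW', rfl⟩ := Finset.mem_image.1 hW
    exact H.block_mem W' hW'
  -- Common arrivals, additional arrivals of `N₁`, common departures, additional departures of `N₂`
  -- in a block of `N₁` and in other blocks, and void jumps.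
  have c1 := Coupled.sum (s := Finset.univ) fun (d : D) _ =>
    (H.coupled_arrivalMean d h).smul (N₂.arrivalRate_pos d).le
  have c2 := Coupled.sum (s := Finset.univ) (T := Dom ρ) fun (d : D) _ =>
    (((N₁.coupled_arrivalMean_unit d x).trans (Coupled.single
      (T := fun (_ : Unit) z => z = y) (a := ()) rfl)).mono (T' := Dom ρ) (by
        rintro z z' ⟨-, hz, rfl⟩
        exact h.mono_left hz.le)).smul (sub_nonneg.2 (H.arrivalRate_le d))
  have c3 := Coupled.sum (s := p₁) (T := Dom ρ) fun W hW =>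
    (Coupled.single (h.depart_both H hW)).smul (N₁.blockRate_pos hW).le
  have c4 := Coupled.sum (s := p₁) (T := Dom ρ) fun W hW =>
    (Coupled.single (h.depart_right (b W))).smul (sub_nonneg.2 (H.blockRate_le W hW))
  have c5 := Coupled.sum (s := p₂ \ p₁.image b) (T := Dom ρ) fun W hW =>
    (Coupled.single (h.depart_right W)).smul
      (N₂.blockRate_pos (Finset.mem_sdiff.1 hW).1).le
  have c6 := (Coupled.single h).smul (sub_nonneg.2 hΛ)
  have hsum : ∀ g : Finset V → ℝ, ∑ W ∈ p₂, g W = ∑ W ∈ p₂ \ p₁.image b, g W + ∑ W ∈ p₁, g (b W) :=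
    fun g => by rw [← Finset.sum_sdiff hsub, Finset.sum_image H.block_injOn]
  refine (((((c1.add c2).add c3).add c4).add c5).add c6).congr (fun f => ?_) fun f => ?_
  · rw [stepMean, drift_eq, hsum]
    simp only [mul_sub, sub_mul, Finset.sum_sub_distrib, add_mul, ← Finset.sum_mul]
    ring
  · rw [stepMean, drift_eq, hsum, hsum]
    simp only [mul_sub, sub_mul, Finset.sum_sub_distrib, add_mul, ← Finset.sum_mul]
    ring

end Step

end LBNetwork

namespace LBNetwork

variable {D : Type*} {V : Type u} [DecidableEq V]

/-! ### The transformations of a network -/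

/-- The state of `N₁` that agrees with a state of a network `N₂` with more servers. -/
def restrictState {N₁ N₂ : LBNetwork D V} (h : N₁.servers ⊆ N₂.servers) (y : N₂.State) :
    N₁.State := fun w => y ⟨w, h w.2⟩

/-- The pairing of each server of `N₁` with itself. -/
def SameServer (N₁ N₂ : LBNetwork D V) (w₁ : N₁.servers) (w₂ : N₂.servers) : Prop :=
  (w₁ : V) = w₂

/-- The pairing for an edge simplification: each server is paired with itself and `u` is also paired
with the new server `v`. -/
def SameServerOr (N₁ N₂ : LBNetwork D V) (u v : V) (w₁ : N₁.servers) (w₂ : N₂.servers) : Prop :=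
  (w₁ : V) = w₂ ∨ ((w₁ : V) = u ∧ (w₂ : V) = v)

theorem mem_nbhd (N : LBNetwork D V) {d : D} {w : N.servers} :
    w ∈ N.nbhd d ↔ (d, (w : V)) ∈ N.edges := Iff.rfl

theorem blockRate_le_of_mem {N₁ N₂ : LBNetwork D V} {W W' : Finset V} {w : V}
    (hW : W ∈ N₁.partition.parts) (hw : w ∈ W) (hW' : W' ∈ N₂.partition.parts) (hw' : w ∈ W')
    (h : N₁.serviceRate w ≤ N₂.serviceRate w) : N₁.blockRate W ≤ N₂.blockRate W' := by
  rwa [N₁.blockRate_eq hW hw, N₂.blockRate_eq hW' hw']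

/-- A sufficient condition for domination when no edges are removed. -/
theorem dominates_sameServer {N₁ N₂ : LBNetwork D V} (hS : N₁.servers ⊆ N₂.servers)
    (hE : N₁.edges ⊆ N₂.edges) (hE' : ∀ e ∈ N₂.edges, e.2 ∈ N₁.servers → e ∈ N₁.edges)
    (hP : N₁.partition.parts ⊆ N₂.partition.parts)
    (hl : ∀ d, N₂.arrivalRate d ≤ N₁.arrivalRate d)
    (hm : ∀ w ∈ N₁.servers, N₁.serviceRate w ≤ N₂.serviceRate w) :
    Dominates N₁ N₂ (SameServer N₁ N₂) id where
  arrivalRate_le := hl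
  exists_nbhd d w₁ hw₁ := ⟨⟨w₁, hS w₁.2⟩, hE hw₁, rfl⟩
  mem_nbhd d w₂ hw₂ w₁ h := by
    rw [mem_nbhd] at hw₂ ⊢
    rw [SameServer] at h
    rw [← h] at hw₂
    exact hE' _ hw₂ w₁.2
  right_unique d w₂ _ w₂' _ w₁ h h' := Subtype.ext (h.symm.trans h')
  left_unique w₁ w₁' w₂ h h' := Subtype.ext (h.trans h'.symm)
  block_mem W hW := hP hW
  block_injOn := Set.injOn_id _
  blockRate_le W hW := by
    obtain ⟨w, hw⟩ := N₁.partition.nonempty_of_mem_parts hW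
    exact blockRate_le_of_mem hW hw (hP hW) hw (hm w (N₁.partition.le hW hw))
  mem_block W _ w₁ w₂ h hw := by
    rw [SameServer] at h
    rwa [h] at hw

theorem ArrivalRateDecrease.dominates {N₁ N₂ : LBNetwork D V} (h : ArrivalRateDecrease N₁ N₂) :
    Dominates N₁ N₂ (SameServer N₁ N₂) id :=
  dominates_sameServer h.servers_eq.ge h.edges_eq.ge (fun _ he _ => h.edges_eq ▸ he)
    h.parts_eq.ge h.arrivalRate_le fun w hw => (h.serviceRate_eq w hw).ge

theorem ServiceRateIncrease.dominates {N₁ N₂ : LBNetwork D V} (h : ServiceRateIncrease N₁ N₂) :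
    Dominates N₁ N₂ (SameServer N₁ N₂) id :=
  dominates_sameServer h.servers_eq.ge h.edges_eq.ge (fun _ he _ => h.edges_eq ▸ he)
    h.parts_eq.ge (fun d => (h.arrivalRate_eq d).le) h.serviceRate_le

theorem ServerAddition.dominates {N₁ N₂ : LBNetwork D V} {d : D} {u : V}
    (h : ServerAddition N₁ N₂ d u) : Dominates N₁ N₂ (SameServer N₁ N₂) id := by
  refine dominates_sameServer ?_ ?_ ?_ ?_ (fun e => (h.arrivalRate_eq e).le)
    fun w hw => (h.serviceRate_old w hw).ge
  · rw [h.servers_eq]; exact Finset.subset_insert _ _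
  · rw [h.edges_eq]; exact Set.subset_union_left
  · intro e he he'
    rw [h.edges_eq] at he
    rcases he with he | rfl
    · exact he
    · exact absurd he' h.notMem_servers
  · rw [h.parts_eq]; exact Finset.subset_union_left

theorem SimpleTransformation.dominates {N₁ N₂ : LBNetwork D V} (h : SimpleTransformation N₁ N₂) :
    Dominates N₁ N₂ (SameServer N₁ N₂) id := by
  rcases h with h | h | ⟨d, u, h⟩
  exacts [h.dominates, h.dominates, h.dominates]

theorem EdgeSimplification.dominates {N₁ N₂ : LBNetwork D V} {d : D} {u v : V}
    (h : EdgeSimplification N₁ N₂ d u v) : Dominates N₁ N₂ (SameServerOr N₁ N₂ u v)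
      (fun W => if W = N₁.partition.part u then insert v W else W) := by
  have hv : ∀ w : N₁.servers, (w : V) ≠ v := fun w he => h.notMem_servers (he ▸ w.2)
  have hE : ∀ e w, (e, w) ∈ N₂.edges ↔ ((e, w) ∈ N₁.edges ∧ ¬(e = d ∧ w = u)) ∨ (e = d ∧ w = v) :=
    fun e w => by simp [h.edges_eq, or_comm]
  have hvE : ∀ e, (e, v) ∉ N₁.edges := fun e he => h.notMem_servers (N₁.edges_subset _ he)
  have hU : N₁.partition.part u ∈ N₁.partition.parts := N₁.partition.part_mem.2 h.mem_servers
  have huU : u ∈ N₁.partition.part u := N₁.partition.mem_part h.mem_servers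
  have hvW : ∀ W ∈ N₁.partition.parts, v ∉ W := fun W hW hvW =>
    h.notMem_servers (N₁.partition.le hW hvW)
  have hmem : ∀ W ∈ N₁.partition.parts,
      (if W = N₁.partition.part u then insert v W else W) ∈ N₂.partition.parts := fun W hW => by
    rw [h.parts_eq]
    split_ifs with hWu
    · simp [hWu]
    · simp [hWu, hW]
  refine ⟨fun e => (h.arrivalRate_eq e).le, fun e w₁ hw₁ => ?_, fun e w₂ hw₂ w₁ hρ => ?_,
    fun e w₂ hw₂ w₂' hw₂' w₁ hρ hρ' => ?_, fun w₁ w₁' w₂ hρ hρ' => ?_, hmem,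
    fun W hW W' hW' he => ?_, fun W hW => ?_, fun W hW w₁ w₂ hρ hw => ?_⟩
  · by_cases hc : e = d ∧ (w₁ : V) = u
    · exact ⟨⟨v, h.new_mem_servers⟩, (hE _ _).2 (Or.inr ⟨hc.1, rfl⟩), Or.inr ⟨hc.2, rfl⟩⟩
    · exact ⟨⟨w₁, h.subset w₁.2⟩, (hE _ _).2 (Or.inl ⟨hw₁, hc⟩), Or.inl rfl⟩
  · rw [mem_nbhd, hE] at hw₂
    rw [mem_nbhd]
    rcases hρ with hρ | ⟨hρ, hρ'⟩
    · rw [← hρ] at hw₂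
      rcases hw₂ with hw₂ | hw₂
      exacts [hw₂.1, absurd hw₂.2 (hv w₁)]
    · rw [hρ'] at hw₂
      rcases hw₂ with hw₂ | hw₂
      · exact absurd hw₂.1 (hvE e)
      · rw [hρ, hw₂.1]
        exact h.mem_edges
  · rw [mem_nbhd, hE] at hw₂ hw₂'
    have huv : u ≠ v := fun he => h.notMem_servers (he ▸ h.mem_servers)
    refine Subtype.ext ?_
    have := hvE e
    rcases hρ with hρ | ⟨hρ, hρ1⟩ <;> rcases hρ' with hρ' | ⟨hρ', hρ1'⟩ <;> grind
  · have := hv w₁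
    have := hv w₁'
    refine Subtype.ext ?_
    rcases hρ with hρ | ⟨hρ, hρ1⟩ <;> rcases hρ' with hρ' | ⟨hρ', hρ1'⟩ <;> grind
  · have := hvW W hW
    have := hvW W' hW'
    split_ifs at he with h1 h2 h2
    · rw [h1, h2]
    · exact absurd (he ▸ Finset.mem_insert_self v W) (hvW W' hW')
    · exact absurd (he ▸ Finset.mem_insert_self v W') (hvW W hW)
    · exact he
  · obtain ⟨w, hw⟩ := N₁.partition.nonempty_of_mem_parts hW
    refine blockRate_le_of_mem hW hw (hmem W hW) ?_
      (h.serviceRate_old w (N₁.partition.le hW hw)).ge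
    split_ifs
    exacts [Finset.mem_insert_of_mem hw, hw]
  · rcases hρ with hρ | ⟨hρ, hρ'⟩
    · rw [← hρ]
      split_ifs
      exacts [Finset.mem_insert_of_mem hw, hw]
    · rw [hρ] at hw
      rw [if_pos (N₁.partition.part_eq_of_mem hW hw).symm, hρ']
      exact Finset.mem_insert_self _ _

theorem dom_sameServer_restrictState {N₁ N₂ : LBNetwork D V} (h : N₁.servers ⊆ N₂.servers)
    (y : N₂.State) : Dom (SameServer N₁ N₂) (restrictState h y) y := by
  rintro w₁ ⟨w₂, hw₂⟩ rfl
  exact le_rfl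

theorem dom_sameServerOr_restrictState {N₁ N₂ : LBNetwork D V} {u v : V}
    (h : N₁.servers ⊆ N₂.servers) {y : N₂.State} {hu : u ∈ N₂.servers} {hv : v ∈ N₂.servers}
    (hy : y ⟨v, hv⟩ ≤ y ⟨u, hu⟩) : Dom (SameServerOr N₁ N₂ u v) (restrictState h y) y := by
  rintro ⟨w₁, hw₁⟩ ⟨w₂, hw₂⟩ (rfl | ⟨rfl, rfl⟩)
  exacts [le_rfl, hy]

section Simulation

variable [Fintype D]

/-- The relation `T` between the states of two networks can be maintained by coupling the jumps. -/
def IsSimulation (N₁ N₂ : LBNetwork D V) (T : N₁.State → N₂.State → Prop) : Prop :=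
  ∃ Λ₀ : ℝ, ∀ Λ, Λ₀ ≤ Λ → ∀ x y, T x y → Coupled T (N₁.stepMean Λ x) (N₂.stepMean Λ y)

theorem Dominates.isSimulation {N₁ N₂ : LBNetwork D V} {ρ : N₁.servers → N₂.servers → Prop}
    {b : Finset V → Finset V} (H : Dominates N₁ N₂ ρ b) : IsSimulation N₁ N₂ (Dom ρ) :=
  ⟨_, fun _ hΛ _ _ h => H.coupled_stepMean hΛ h⟩

theorem IsSimulation.trans {N₁ N₂ N₃ : LBNetwork D V} {T : N₁.State → N₂.State → Prop}
    {T' : N₂.State → N₃.State → Prop} (h : IsSimulation N₁ N₂ T) (h' : IsSimulation N₂ N₃ T') :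
    IsSimulation N₁ N₃ (fun x z => ∃ y, T x y ∧ T' y z) := by
  obtain ⟨Λ₀, h⟩ := h
  obtain ⟨Λ₁, h'⟩ := h'
  refine ⟨max Λ₀ Λ₁, fun Λ hΛ x z ⟨y, hxy, hyz⟩ => ?_⟩
  exact (h Λ ((le_max_left _ _).trans hΛ) x y hxy).trans
    (h' Λ ((le_max_right _ _).trans hΛ) y z hyz)

/-- A transformation leads to a simulation that contains the pairs of a state and its restriction,
if the new servers are idle, and that is contained in the coordinatewise order. -/
theorem Transformation.exists_isSimulation {N₁ N₂ : LBNetwork D V} (h : Transformation N₁ N₂) :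
    ∃ (hS : N₁.servers ⊆ N₂.servers) (T : N₁.State → N₂.State → Prop), IsSimulation N₁ N₂ T ∧
      (∀ x y, T x y → restrictState hS y ≤ x) ∧
      ∀ y : N₂.State, (∀ w : N₂.servers, (w : V) ∉ N₁.servers → y w = 0) → T (restrictState hS y) y := by
  rcases h with ⟨d, u, v, h⟩ | h
  · refine ⟨h.subset, _, h.dominates.isSimulation, fun x y hxy w => hxy _ _ (Or.inl rfl),
      fun y hy => dom_sameServerOr_restrictState (hu := h.subset h.mem_servers)
        (hv := h.new_mem_servers) h.subset ?_⟩
    rw [hy _ h.notMem_servers]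
    exact Nat.zero_le _
  · exact ⟨h.subset, _, h.dominates.isSimulation, fun x y hxy w => hxy _ _ rfl,
      fun y _ => dom_sameServer_restrictState _ y⟩

theorem FiniteComposition.exists_isSimulation {N₁ N₂ : LBNetwork D V}
    (h : FiniteComposition N₁ N₂) :
    ∃ (hS : N₁.servers ⊆ N₂.servers) (T : N₁.State → N₂.State → Prop), IsSimulation N₁ N₂ T ∧
      (∀ x y, T x y → restrictState hS y ≤ x) ∧
      ∀ y : N₂.State, (∀ w : N₂.servers, (w : V) ∉ N₁.servers → y w = 0) → T (restrictState hS y) y := by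
  induction h with
  | refl =>
    exact Transformation.exists_isSimulation
      (.simple (.arrival ⟨rfl, rfl, rfl, fun _ => le_rfl, fun _ _ => rfl⟩))
  | tail _ h' ih =>
    obtain ⟨hS, T, hsim, hle, hT⟩ := ih
    obtain ⟨hS', T', hsim', hle', hT'⟩ := h'.exists_isSimulation
    refine ⟨hS.trans hS', _, hsim.trans hsim', ?_, fun z hz => ⟨restrictState hS' z, ?_, ?_⟩⟩
    · rintro x z ⟨y, hxy, hyz⟩ w
      exact (hle' y z hyz ⟨w, hS w.2⟩).trans (hle x y hxy w)
    · exact hT _ fun w hw => hz ⟨w, hS' w.2⟩ hw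
    · exact hT' z fun w hw => hz w fun hw' => hw (hS hw')

end Simulation

end LBNetwork

/-! ### Sequences of independent variables -/

/-- The sequence obtained by prepending a term. -/
def consSeq {E : Type*} (p : E × (ℕ → E)) : ℕ → E
  | 0 => p.1
  | n + 1 => p.2 n

theorem measurable_consSeq {E : Type*} [MeasurableSpace E] :
    Measurable (consSeq : E × (ℕ → E) → ℕ → E) := by
  refine measurable_pi_lambda _ fun n => ?_
  cases n with
  | zero => exact measurable_fst
  | succ n => exact (measurable_pi_apply n).comp measurable_snd

/-- Prepending an independent term to an i.i.d. sequence gives an i.i.d. sequence. -/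
theorem measurePreserving_consSeq {E : Type*} [MeasurableSpace E] (μ : Measure E)
    [IsProbabilityMeasure μ] :
    MeasurePreserving consSeq (μ.prod (Measure.infinitePi fun _ : ℕ => μ))
      (Measure.infinitePi fun _ : ℕ => μ) := by
  classical
  refine ⟨measurable_consSeq, Measure.eq_infinitePi _ fun s t ht => ?_⟩
  -- The terms outside `s` are unconstrained, so that `s` can be replaced by an initial segment.
  let t' : ℕ → Set E := fun i => if i ∈ s then t i else Set.univ
  have ht' : ∀ i, MeasurableSet (t' i) := fun i => by
    simp only [t']
    split_ifs
    exacts [ht i, MeasurableSet.univ]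
  obtain ⟨n, hn⟩ : ∃ n, s ⊆ Finset.range (n + 1) :=
    ⟨s.sup id, fun i hi => Finset.mem_range.2 (Nat.lt_succ_of_le (Finset.le_sup (f := id) hi))⟩
  have hset : consSeq ⁻¹' ((s : Set ℕ).pi t) =
      t' 0 ×ˢ ((Finset.range n : Set ℕ).pi fun i => t' (i + 1)) := by
    ext ⟨e, ω⟩
    simp only [Set.mem_preimage, Set.mem_pi, Set.mem_prod, Finset.mem_coe, t']
    constructor
    · intro h
      refine ⟨?_, fun i _ => ?_⟩
      · split_ifs with h0
        exacts [h 0 h0, trivial]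
      · split_ifs with h0
        exacts [h _ h0, trivial]
    · rintro ⟨h0, h1⟩ i hi
      cases i with
      | zero => simpa [hi, consSeq] using h0
      | succ i =>
        have := h1 i (by have := hn hi; simpa using this)
        simpa [hi, consSeq] using this
  rw [Measure.map_apply measurable_consSeq (.pi s.countable_toSet fun _ _ => ht _), hset,
    Measure.prod_prod, Measure.infinitePi_pi _ fun i _ => ht' _]
  have hprod : ∏ i ∈ s, μ (t i) = ∏ i ∈ Finset.range (n + 1), μ (t' i) := by
    rw [← Finset.prod_subset hn fun i _ hi => by simp [t', hi]]
    exact Finset.prod_congr rfl fun i hi => by simp [t', hi]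
  rw [hprod, Finset.prod_range_succ', mul_comm]

theorem integral_infinitePi_eq {E : Type*} [MeasurableSpace E] (μ : Measure E)
    [IsProbabilityMeasure μ] {g : (ℕ → E) → ℝ}
    (hg : Integrable g (Measure.infinitePi fun _ : ℕ => μ)) :
    ∫ ω, g ω ∂(Measure.infinitePi fun _ : ℕ => μ) =
      ∫ e, ∫ ω, g (consSeq (e, ω)) ∂(Measure.infinitePi fun _ : ℕ => μ) ∂μ := by
  have h := measurePreserving_consSeq μ
  rw [← integral_prod (fun p => g (consSeq p)) (h.integrable_comp_of_integrable hg), ← h.map_eq,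
    integral_map measurable_consSeq.aemeasurable (by rw [h.map_eq]; exact hg.1), h.map_eq]

/-! ### Exponential waiting times -/

/-- The exponential distribution on the nonnegative reals. -/
noncomputable def waitingTime (Λ : ℝ) : Measure ℝ≥0 := (expMeasure Λ).map Real.toNNReal

theorem isProbabilityMeasure_waitingTime {Λ : ℝ} (hΛ : 0 < Λ) :
    IsProbabilityMeasure (waitingTime Λ) := by
  have := isProbabilityMeasure_expMeasure hΛ
  exact Measure.isProbabilityMeasure_map measurable_real_toNNReal.aemeasurable

theorem setIntegral_waitingTime_Ioi {Λ : ℝ} (hΛ : 0 < Λ) {g : ℝ≥0 → ℝ} (hg : Measurable g)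
    (s : ℝ≥0) : ∫ τ in Set.Ioi s, g τ ∂waitingTime Λ =
      ∫ t in Set.Ioi (s : ℝ), Λ * Real.exp (-(Λ * t)) * g t.toNNReal := by
  have hpre : Real.toNNReal ⁻¹' Set.Ioi s = Set.Ioi (s : ℝ) := by
    ext t
    simp [Real.lt_toNNReal_iff_coe_lt]
  rw [waitingTime, setIntegral_map measurableSet_Ioi hg.aestronglyMeasurable
    measurable_real_toNNReal.aemeasurable, hpre]
  have hexp : expMeasure Λ = volume.withDensity (exponentialPDF Λ) := rfl
  rw [hexp, setIntegral_withDensity_eq_setIntegral_toReal_smul₀]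
  · refine setIntegral_congr_fun measurableSet_Ioi fun t ht => ?_
    have h0 : (0 : ℝ) ≤ t := s.2.trans (le_of_lt ht)
    simp only [exponentialPDF_of_nonneg h0, smul_eq_mul]
    rw [ENNReal.toReal_ofReal (by positivity)]
  · exact (measurable_exponentialPDFReal Λ).ennreal_ofReal.aemeasurable
  · exact Eventually.of_forall fun t => ENNReal.ofReal_lt_top
  · exact measurableSet_Ioi

theorem waitingTime_real_Ioi {Λ : ℝ} (hΛ : 0 < Λ) (s : ℝ≥0) :
    (waitingTime Λ).real (Set.Ioi s) = Real.exp (-(Λ * s)) := by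
  have := isProbabilityMeasure_expMeasure hΛ
  have hpre : Real.toNNReal ⁻¹' Set.Ioi s = (Set.Iic (s : ℝ))ᶜ := by
    ext t
    simp [Real.lt_toNNReal_iff_coe_lt]
  rw [waitingTime, map_measureReal_apply measurable_real_toNNReal measurableSet_Ioi, hpre,
    probReal_compl_eq_one_sub measurableSet_Iic, ← cdf_eq_real, cdf_expMeasure_eq hΛ,
    if_pos s.coe_nonneg, sub_sub_cancel]

theorem waitingTime_ae_pos {Λ : ℝ} (hΛ : 0 < Λ) : ∀ᵐ τ ∂waitingTime Λ, 0 < τ := by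
  have := isProbabilityMeasure_waitingTime hΛ
  have h := waitingTime_real_Ioi hΛ 0
  rw [NNReal.coe_zero, mul_zero, neg_zero, Real.exp_zero, measureReal_def, ENNReal.toReal_eq_one_iff] at h
  exact (mem_ae_iff_prob_eq_one measurableSet_Ioi).2 h

theorem waitingTime_real_Iic {Λ : ℝ} (hΛ : 0 < Λ) (s : ℝ≥0) :
    (waitingTime Λ).real (Set.Iic s) = 1 - Real.exp (-(Λ * s)) := by
  have := isProbabilityMeasure_waitingTime hΛ
  rw [← waitingTime_real_Ioi hΛ, ← Set.compl_Ioi, probReal_compl_eq_one_sub measurableSet_Ioi]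

/-- Iteration of a bound by a contraction. -/
theorem eq_zero_of_contraction {ι : Type*} {a : ι → ℝ} {c C : ℝ} (hc0 : 0 ≤ c) (hc : c < 1)
    (hC : ∀ i, |a i| ≤ C) (h : ∀ D, 0 ≤ D → (∀ i, |a i| ≤ D) → ∀ i, |a i| ≤ c * D) (i : ι) :
    a i = 0 := by
  have hC0 : 0 ≤ C := (abs_nonneg _).trans (hC i)
  have hn : ∀ n : ℕ, ∀ i, |a i| ≤ c ^ n * C := fun n => by
    induction n with
    | zero => simpa using hC
    | succ n ih =>
      rw [pow_succ', mul_assoc]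
      exact h _ (by positivity) ih
  have hlim : Tendsto (fun n : ℕ => c ^ n * C) atTop (𝓝 (0 * C)) :=
    (tendsto_pow_atTop_nhds_zero_of_lt_one hc0 hc).mul_const C
  rw [zero_mul] at hlim
  exact abs_nonpos_iff.1 (ge_of_tendsto' hlim fun n => hn n i)

/-! ### The uniformized chain -/

/-- The randomness used by one step of the chain: a waiting time and a uniform variable. -/
abbrev Noise : Type := ℝ≥0 × unitInterval

/-- The law of the randomness used by one step. -/
noncomputable def noise (Λ : ℝ) : Measure Noise := (waitingTime Λ).prod volume

/-- The law of the randomness used by all the steps. -/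
noncomputable def noiseSeq (Λ : ℝ) : Measure (ℕ → Noise) := Measure.infinitePi fun _ => noise Λ

theorem isProbabilityMeasure_noise {Λ : ℝ} (hΛ : 0 < Λ) : IsProbabilityMeasure (noise Λ) := by
  have := isProbabilityMeasure_waitingTime hΛ
  exact inferInstanceAs (IsProbabilityMeasure ((waitingTime Λ).prod volume))

theorem isProbabilityMeasure_noiseSeq {Λ : ℝ} (hΛ : 0 < Λ) :
    IsProbabilityMeasure (noiseSeq Λ) := by
  have := isProbabilityMeasure_noise hΛ
  exact inferInstanceAs (IsProbabilityMeasure (Measure.infinitePi fun _ : ℕ => noise Λ))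

theorem noise_real_fst {Λ : ℝ} (A : Set ℝ≥0) :
    (noise Λ).real (Prod.fst ⁻¹' A) = (waitingTime Λ).real A := by
  have : Prod.fst ⁻¹' A = A ×ˢ (Set.univ : Set unitInterval) := by ext; simp
  rw [this, noise, measureReal_prod_prod]
  simp

/-- The time of the `n`-th jump. -/
noncomputable def jumpTime (ω : ℕ → Noise) (n : ℕ) : ℝ≥0 := ∑ i ∈ Finset.range n, (ω i).1

/-- The number of jumps up to time `t`. -/
noncomputable def jumpCount (ω : ℕ → Noise) (t : ℝ≥0) : ℕ := sInf {n | t < jumpTime ω (n + 1)}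

/-- There are finitely many jumps in bounded time intervals. -/
def NonExplosive (ω : ℕ → Noise) : Prop := ∀ t, ∃ n, t < jumpTime ω (n + 1)

theorem jumpTime_mono (ω : ℕ → Noise) : Monotone (jumpTime ω) := fun _ _ h =>
  Finset.sum_le_sum_of_subset (Finset.range_mono h)

theorem measurable_jumpTime (n : ℕ) : Measurable fun ω => jumpTime ω n :=
  Finset.measurable_sum _ fun i _ => measurable_fst.comp (measurable_pi_apply i)

theorem jumpTime_consSeq (e : Noise) (ω : ℕ → Noise) (n : ℕ) :
    jumpTime (consSeq (e, ω)) (n + 1) = jumpTime ω n + e.1 := by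
  rw [jumpTime, Finset.sum_range_succ']
  rfl

theorem jumpCount_consSeq_of_lt {e : Noise} {ω : ℕ → Noise} {t : ℝ≥0} (h : t < e.1) :
    jumpCount (consSeq (e, ω)) t = 0 := by
  refine Nat.sInf_eq_zero.2 (Or.inl ?_)
  simpa [jumpTime, consSeq] using h

theorem jumpCount_consSeq_of_le {e : Noise} {ω : ℕ → Noise} {t : ℝ≥0} (hω : NonExplosive ω)
    (h : e.1 ≤ t) : jumpCount (consSeq (e, ω)) t = jumpCount ω (t - e.1) + 1 := by
  have hmem : ∀ n, t < jumpTime (consSeq (e, ω)) (n + 1 + 1) ↔ t - e.1 < jumpTime ω (n + 1) :=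
    fun n => by rw [jumpTime_consSeq, tsub_lt_iff_right h]
  have hne : {n | t - e.1 < jumpTime ω (n + 1)}.Nonempty := hω _
  refine le_antisymm (Nat.sInf_le ((hmem _).2 (Nat.sInf_mem hne))) ?_
  have hne' : {n | t < jumpTime (consSeq (e, ω)) (n + 1)}.Nonempty :=
    ⟨_, (hmem _).2 (Nat.sInf_mem hne)⟩
  have hm := Nat.sInf_mem hne'
  change _ + 1 ≤ sInf {n | t < jumpTime (consSeq (e, ω)) (n + 1)}
  rcases hk : sInf {n | t < jumpTime (consSeq (e, ω)) (n + 1)} with _ | k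
  · rw [hk] at hm
    exact absurd hm (by simpa [jumpTime, consSeq] using h)
  · rw [hk] at hm
    exact Nat.succ_le_succ (Nat.sInf_le ((hmem k).1 hm))

theorem measurable_jumpCount (t : ℝ≥0) : Measurable fun ω => jumpCount ω t := by
  refine measurable_of_Iic fun n => ?_
  have : (fun ω => jumpCount ω t) ⁻¹' Set.Iic n =
      {ω | t < jumpTime ω (n + 1)} ∪ ⋂ m : ℕ, {ω | jumpTime ω (m + 1) ≤ t} := by
    ext ω
    simp only [Set.mem_preimage, Set.mem_Iic, Set.mem_union, Set.mem_ofPred_eq, Set.mem_iInter]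
    constructor
    · intro h
      by_cases hne : {n | t < jumpTime ω (n + 1)}.Nonempty
      · exact Or.inl (lt_of_lt_of_le (Nat.sInf_mem hne) (jumpTime_mono ω (Nat.succ_le_succ h)))
      · exact Or.inr fun m => not_lt.1 fun hm => hne ⟨m, hm⟩
    · rintro (h | h)
      · exact Nat.sInf_le h
      · have : {n | t < jumpTime ω (n + 1)} = ∅ :=
          Set.eq_empty_of_forall_notMem fun m hm => (h m).not_gt hm
        rw [jumpCount, this, Nat.sInf_empty]
        exact Nat.zero_le n
  rw [this]
  exact (measurableSet_lt measurable_const (measurable_jumpTime _)).union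
    (MeasurableSet.iInter fun m => measurableSet_le (measurable_jumpTime _) measurable_const)

theorem ae_nonExplosive {Λ : ℝ} (hΛ : 0 < Λ) : ∀ᵐ ω ∂noiseSeq Λ, NonExplosive ω := by
  have := isProbabilityMeasure_noise hΛ
  have := isProbabilityMeasure_noiseSeq hΛ
  have := isProbabilityMeasure_waitingTime hΛ
  -- `B t` is the event that all the jump times are at most `t`, and `q t` is its probability. By first
  -- step analysis, `q t` is at most `q t` times the probability of a waiting time of at most `t`.
  let B : ℝ≥0 → Set (ℕ → Noise) := fun t => {ω | ∀ n, jumpTime ω (n + 1) ≤ t}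
  have hB : ∀ t, MeasurableSet (B t) := fun t => by
    simp only [B, Set.ofPred_forall]
    exact MeasurableSet.iInter fun m => measurableSet_le (measurable_jumpTime _) measurable_const
  let q : ℝ≥0 → ℝ := fun t => (noiseSeq Λ).real (B t)
  have hq : ∀ t, q t ≤ (waitingTime Λ).real (Set.Iic t) * q t := fun t => by
    have hsub : consSeq ⁻¹' B t ⊆ (Prod.fst ⁻¹' Set.Iic t) ×ˢ B t := by
      rintro ⟨e, ω⟩ h
      have h' : ∀ n, jumpTime ω n + e.1 ≤ t := fun n => jumpTime_consSeq e ω n ▸ h n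
      exact ⟨le_add_self.trans (h' 0), fun n => le_self_add.trans (h' (n + 1))⟩
    have hmp : MeasurePreserving consSeq ((noise Λ).prod (noiseSeq Λ)) (noiseSeq Λ) :=
      measurePreserving_consSeq (noise Λ)
    rw [← noise_real_fst, ← measureReal_prod_prod]
    refine le_trans (le_of_eq ?_) (measureReal_mono hsub)
    rw [Measure.real, hmp.measure_preimage (hB t).nullMeasurableSet]
    rfl
  have hq0 : ∀ t, q t = 0 := fun t => by
    have h := hq t
    rw [waitingTime_real_Iic hΛ] at h
    have hpos := Real.exp_pos (-(Λ * t))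
    have h0 : 0 ≤ q t := measureReal_nonneg
    nlinarith
  have hae : ∀ k : ℕ, ∀ᵐ ω ∂noiseSeq Λ, ω ∉ B k := fun k => by
    have := hq0 k
    rw [measureReal_eq_zero_iff] at this
    exact measure_eq_zero_iff_ae_notMem.1 this
  filter_upwards [ae_all_iff.2 hae] with ω hω t
  obtain ⟨k, hk⟩ := exists_nat_ge t
  have := hω k
  simp only [B, Set.mem_ofPred_eq, not_forall, not_le] at this
  obtain ⟨n, hn⟩ := this
  exact ⟨n, hk.trans_lt hn⟩

section Path

variable {S : Type u} (φ : S → unitInterval → S)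

/-- The state after `n` jumps of the chain that moves from `x` to `φ x U`, where `U` is uniform. -/
def jumpState : ℕ → S → (ℕ → Noise) → S
  | 0, x, _ => x
  | n + 1, x, ω => jumpState n (φ x (ω 0).2) fun k => ω (k + 1)

/-- The state at time `t` of the continuous-time chain with initial state `x`. -/
noncomputable def chainPath (x : S) (ω : ℕ → Noise) (t : ℝ≥0) : S := jumpState φ (jumpCount ω t) x ω

/-- The path that stays at `x` until time `τ` and then continues as `p`. -/
noncomputable def gluePath (x : S) (τ : ℝ≥0) (p : ℝ≥0 → S) (t : ℝ≥0) : S := if t < τ then x else p (t - τ)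

theorem chainPath_consSeq {ω : ℕ → Noise} (hω : NonExplosive ω) (x : S) (e : Noise) :
    chainPath φ x (consSeq (e, ω)) = gluePath x e.1 (chainPath φ (φ x e.2) ω) := by
  funext t
  rw [chainPath, gluePath]
  split_ifs with h
  · rw [jumpCount_consSeq_of_lt h]
    rfl
  · rw [jumpCount_consSeq_of_le hω (not_lt.1 h)]
    rfl

theorem jumpCount_mono {ω : ℕ → Noise} (hω : NonExplosive ω) : Monotone (jumpCount ω) := fun _ t h =>
  Nat.sInf_le (h.trans_lt (Nat.sInf_mem (s := {n | t < jumpTime ω (n + 1)}) (hω t)))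

theorem continuousWithinAt_chainPath [TopologicalSpace S] {ω : ℕ → Noise} (hω : NonExplosive ω)
    (x : S) (t : ℝ≥0) : ContinuousWithinAt (chainPath φ x ω) (Set.Ici t) t := by
  have hev : chainPath φ x ω =ᶠ[𝓝[≥] t] fun _ => chainPath φ x ω t := by
    have hlt : t < jumpTime ω (jumpCount ω t + 1) :=
      Nat.sInf_mem (s := {n | t < jumpTime ω (n + 1)}) (hω t)
    filter_upwards [self_mem_nhdsWithin, mem_nhdsWithin_of_mem_nhds (Iio_mem_nhds hlt)]
      with s hs hs'
    have : jumpCount ω s = jumpCount ω t :=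
      le_antisymm (Nat.sInf_le hs') (jumpCount_mono hω hs)
    rw [chainPath, chainPath, this]
  exact tendsto_const_nhds.congr' (hev.mono fun s hs => hs.symm)

theorem exists_leftLimit_chainPath [TopologicalSpace S] {ω : ℕ → Noise} (hω : NonExplosive ω)
    (x : S) (t : ℝ≥0) : ∃ l, Tendsto (chainPath φ x ω) (𝓝[<] t) (𝓝 l) := by
  by_cases ht : t = 0
  · refine ⟨x, ?_⟩
    have : 𝓝[<] t = ⊥ := by
      rw [ht, show Set.Iio (0 : ℝ≥0) = ∅ from Set.Iio_bot, nhdsWithin_empty]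
    rw [this]
    exact tendsto_bot
  -- `M` is the number of jumps before `t`.
  let A : Set ℕ := jumpCount ω '' Set.Iio t
  have hA : A.Nonempty := ⟨_, 0, pos_iff_ne_zero.2 ht, rfl⟩
  have hbdd : BddAbove A := ⟨jumpCount ω t, by
    rintro _ ⟨s, hs, rfl⟩
    exact jumpCount_mono hω (le_of_lt hs)⟩
  obtain ⟨s₀, hs₀, hM⟩ := Nat.sSup_mem hA hbdd
  refine ⟨jumpState φ (sSup A) x ω, tendsto_const_nhds.congr' ?_⟩
  filter_upwards [self_mem_nhdsWithin, mem_nhdsWithin_of_mem_nhds (Ioi_mem_nhds hs₀)] with s hs hs'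
  have : jumpCount ω s = sSup A := by
    refine le_antisymm (le_csSup hbdd ⟨s, hs, rfl⟩) ?_
    rw [← hM]
    exact jumpCount_mono hω (le_of_lt hs')
  rw [chainPath, this]

variable {φ}

/-- The expectation of a functional of the path of the chain with initial state `x`. -/
noncomputable def pathMean (φ : S → unitInterval → S) (Λ : ℝ) (x : S) (Φ : (ℝ≥0 → S) → ℝ) : ℝ :=
  ∫ ω, Φ (chainPath φ x ω) ∂noiseSeq Λ

theorem abs_pathMean_le {Λ : ℝ} (hΛ : 0 < Λ) (x : S)
    {Φ : (ℝ≥0 → S) → ℝ} {C : ℝ} (hC : ∀ p, |Φ p| ≤ C) : |pathMean φ Λ x Φ| ≤ C := by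
  have := isProbabilityMeasure_noiseSeq hΛ
  have := norm_integral_le_of_norm_le_const (μ := noiseSeq Λ)
    (f := fun ω => Φ (chainPath φ x ω)) (Eventually.of_forall fun ω => hC _)
  simpa [pathMean] using this

variable [MeasurableSpace S]

theorem measurable_gluePath (x : S) (τ : ℝ≥0) : Measurable (gluePath x τ) := by
  refine measurable_pi_lambda _ fun t => ?_
  by_cases h : t < τ
  · simp only [gluePath, h, if_true]
    exact measurable_const
  · simp only [gluePath, h, if_false]
    exact measurable_pi_apply _

theorem measurable_jumpState (hφ : Measurable (Function.uncurry φ)) (n : ℕ) :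
    Measurable fun p : S × (ℕ → Noise) => jumpState φ n p.1 p.2 := by
  induction n with
  | zero => exact measurable_fst
  | succ n ih =>
    refine ih.comp (Measurable.prodMk (hφ.comp (measurable_fst.prodMk ?_)) ?_)
    · exact measurable_snd.comp ((measurable_pi_apply 0).comp measurable_snd)
    · exact measurable_pi_lambda _ fun k => (measurable_pi_apply (k + 1)).comp measurable_snd

theorem measurable_chainPath_apply (hφ : Measurable (Function.uncurry φ)) (t : ℝ≥0) :
    Measurable fun p : S × (ℕ → Noise) => chainPath φ p.1 p.2 t := by
  have h : Measurable fun q : ℕ × (S × (ℕ → Noise)) => jumpState φ q.1 q.2.1 q.2.2 :=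
    measurable_from_prod_countable_right fun n => measurable_jumpState hφ n
  exact h.comp (((measurable_jumpCount t).comp measurable_snd).prodMk measurable_id)

theorem measurable_chainPath (hφ : Measurable (Function.uncurry φ)) (x : S) :
    Measurable (chainPath φ x) := by
  refine measurable_pi_lambda _ fun t => ?_
  have h : Measurable fun ω : ℕ → Noise => (x, ω) := measurable_prodMk_left
  have h' := (measurable_chainPath_apply hφ t).comp h
  exact h'

theorem integrable_chainPath {Λ : ℝ} (hΛ : 0 < Λ) (hφ : Measurable (Function.uncurry φ)) (x : S)
    {Φ : (ℝ≥0 → S) → ℝ} (hΦ : Measurable Φ) {C : ℝ} (hC : ∀ p, |Φ p| ≤ C) :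
    Integrable (fun ω => Φ (chainPath φ x ω)) (noiseSeq Λ) := by
  have := isProbabilityMeasure_noiseSeq hΛ
  exact Integrable.of_bound (hΦ.comp (measurable_chainPath hφ x)).aestronglyMeasurable C
    (Eventually.of_forall fun ω => hC _)

/-- First step analysis: conditioning on the first waiting time and the first jump. -/
theorem pathMean_eq {Λ : ℝ} (hΛ : 0 < Λ) (hφ : Measurable (Function.uncurry φ)) (x : S)
    {Φ : (ℝ≥0 → S) → ℝ} (hΦ : Measurable Φ) {C : ℝ} (hC : ∀ p, |Φ p| ≤ C) :
    Integrable (fun e : Noise => pathMean φ Λ (φ x e.2) (Φ ∘ gluePath x e.1)) (noise Λ) ∧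
    pathMean φ Λ x Φ = ∫ e, pathMean φ Λ (φ x e.2) (Φ ∘ gluePath x e.1) ∂noise Λ := by
  have := isProbabilityMeasure_noise hΛ
  have := isProbabilityMeasure_noiseSeq hΛ
  have hint := integrable_chainPath hΛ hφ x hΦ hC
  have heq : ∀ e : Noise, ∫ ω, Φ (chainPath φ x (consSeq (e, ω))) ∂noiseSeq Λ =
      pathMean φ Λ (φ x e.2) (Φ ∘ gluePath x e.1) := fun e => by
    refine integral_congr_ae ?_
    filter_upwards [ae_nonExplosive hΛ] with ω hω
    rw [chainPath_consSeq φ hω]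
    rfl
  have h1 := ((measurePreserving_consSeq (noise Λ)).integrable_comp_of_integrable
    hint).integral_prod_left
  have h2 := integral_infinitePi_eq (noise Λ) hint
  exact ⟨h1.congr (Eventually.of_forall heq), h2.trans (integral_congr_ae (Eventually.of_forall heq))⟩

end Path

namespace LBNetwork

/-! ### The transition semigroup of the uniformized chain -/

section Semigroup

theorem hasDerivAt_apply {α : Type*} [TopologicalSpace α] {g : ℝ → α →ᵇ ℝ} {g' : α →ᵇ ℝ} {t : ℝ}
    (h : HasDerivAt g g' t) (x : α) : HasDerivAt (fun t => g t x) (g' x) t := by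
  have h' := (BoundedContinuousFunction.evalCLM (β := ℝ) ℝ x).hasFDerivAt.comp_hasDerivAt t h
  exact h'

variable {D : Type*} {V : Type u} [DecidableEq V] [Fintype D] (N : LBNetwork D V)

theorem stepMean_eq (Λ : ℝ) (f : N.State →ᵇ ℝ) (x : N.State) :
    N.stepMean Λ x f = N.generator f x + Λ * f x := rfl

theorem hasDerivAt_operatorExp (f : N.State →ᵇ ℝ) (t : ℝ) :
    HasDerivAt (fun t : ℝ => operatorExp (t • N.generator) f)
      (N.generator (operatorExp (t • N.generator) f)) t := by
  have h := hasDerivAt_exp_smul_const' (𝕂 := ℝ) N.generator t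
  have h' := h.clm_apply (hasDerivAt_const t f)
  rw [map_zero, add_zero] at h'
  exact h'

theorem continuous_operatorExp (f : N.State →ᵇ ℝ) :
    Continuous fun t : ℝ => operatorExp (t • N.generator) f :=
  continuous_iff_continuousAt.2 fun t => (N.hasDerivAt_operatorExp f t).continuousAt

theorem continuous_stepMean (Λ : ℝ) {Z : Type*} [TopologicalSpace Z] {g : Z → N.State →ᵇ ℝ}
    (hg : Continuous g) (x : N.State) : Continuous fun z => N.stepMean Λ x (g z) := by
  simp only [stepMean_eq]
  have h1 := (BoundedContinuousFunction.evalCLM ℝ x).continuous.comp hg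
  have h2 := (BoundedContinuousFunction.evalCLM ℝ x).continuous.comp
    (N.generator.continuous.comp hg)
  exact h2.add (continuous_const.mul h1)

theorem intervalIntegral_semigroup (Λ : ℝ) (f : N.State →ᵇ ℝ) (x : N.State) (s T : ℝ) :
    ∫ t in s..T, Real.exp (-(Λ * t)) * N.stepMean Λ x (operatorExp ((T - t) • N.generator) f) =
      Real.exp (-(Λ * s)) * operatorExp ((T - s) • N.generator) f x
        - Real.exp (-(Λ * T)) * f x := by
  have hd : ∀ t : ℝ, HasDerivAt (fun t =>
      -(Real.exp (-(Λ * t)) * operatorExp ((T - t) • N.generator) f x))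
      (Real.exp (-(Λ * t)) * N.stepMean Λ x (operatorExp ((T - t) • N.generator) f)) t :=
    fun t => by
    have h1 : HasDerivAt (fun t : ℝ => Real.exp (-(Λ * t))) (Real.exp (-(Λ * t)) * -Λ) t := by
      simpa using (((hasDerivAt_id t).const_mul Λ).neg).exp
    have h2 := (N.hasDerivAt_operatorExp f (T - t)).scomp t ((hasDerivAt_id t).const_sub T)
    have h3 := hasDerivAt_apply h2 x
    refine (h1.mul h3).neg.congr_deriv ?_
    simp only [stepMean_eq, BoundedContinuousFunction.coe_smul, smul_eq_mul, Function.comp_apply]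
    ring
  have hc : Continuous fun t : ℝ =>
      Real.exp (-(Λ * t)) * N.stepMean Λ x (operatorExp ((T - t) • N.generator) f) :=
    (by fun_prop : Continuous fun t : ℝ => Real.exp (-(Λ * t))).mul
      (N.continuous_stepMean Λ ((N.continuous_operatorExp f).comp (continuous_const.sub
        continuous_id)) x)
  rw [intervalIntegral.integral_eq_sub_of_hasDerivAt (fun t _ => hd t) (hc.intervalIntegrable _ _)]
  have h0 : operatorExp ((T - T) • N.generator) f = f := by simp [operatorExp]
  rw [h0]
  ring

theorem continuous_semigroup (f : N.State →ᵇ ℝ) : Continuous fun t => N.semigroup t f :=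
  (N.continuous_operatorExp f).comp NNReal.continuous_coe

theorem exists_semigroup_le (f : N.State →ᵇ ℝ) (T : ℝ≥0) :
    ∃ C, ∀ t ≤ T, ‖N.semigroup t f‖ ≤ C := by
  obtain ⟨C, hC⟩ := (isCompact_Icc (a := 0) (b := T)).exists_bound_of_continuousOn
    (N.continuous_semigroup f).continuousOn
  exact ⟨C, fun t ht => hC t ⟨zero_le, ht⟩⟩

/-- The renewal equation of the semigroup, restricted to the event that the first waiting time is
larger than `s`. -/
theorem setIntegral_waitingTime_semigroup {Λ : ℝ} (hΛ : 0 < Λ) (f : N.State →ᵇ ℝ) (x : N.State)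
    {s T : ℝ≥0} (hs : s ≤ T) :
    ∫ τ in Set.Ioi s, (if T < τ then f x else Λ⁻¹ * N.stepMean Λ x (N.semigroup (T - τ) f))
      ∂waitingTime Λ = Real.exp (-(Λ * s)) * N.semigroup (T - s) f x := by
  have hc : Continuous fun τ => N.stepMean Λ x (N.semigroup (T - τ) f) :=
    N.continuous_stepMean Λ ((N.continuous_semigroup f).comp (by fun_prop)) x
  have hmeas : Measurable fun τ =>
      if T < τ then f x else Λ⁻¹ * N.stepMean Λ x (N.semigroup (T - τ) f) :=
    Measurable.ite measurableSet_Ioi measurable_const (hc.measurable.const_mul _)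
  have hs' : (s : ℝ) ≤ T := hs
  have h1 : ∀ t ∈ Set.Ioc (s : ℝ) T, Λ * Real.exp (-(Λ * t)) *
      (if T < t.toNNReal then f x else Λ⁻¹ * N.stepMean Λ x (N.semigroup (T - t.toNNReal) f)) =
      Real.exp (-(Λ * t)) * N.stepMean Λ x (operatorExp (((T : ℝ) - t) • N.generator) f) := by
    intro t ht
    have h0 : (0 : ℝ) ≤ t := s.2.trans ht.1.le
    have hle : t.toNNReal ≤ T := Real.toNNReal_le_iff_le_coe.2 ht.2
    rw [if_neg (not_lt.2 hle), semigroup, NNReal.coe_sub hle, Real.coe_toNNReal _ h0]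
    field_simp
  have h2 : ∀ t ∈ Set.Ioi (T : ℝ), Λ * Real.exp (-(Λ * t)) *
      (if T < t.toNNReal then f x else Λ⁻¹ * N.stepMean Λ x (N.semigroup (T - t.toNNReal) f)) =
      Λ * Real.exp (-(Λ * t)) * f x := by
    intro t ht
    rw [if_pos (Real.lt_toNNReal_iff_coe_lt.2 ht)]
  have hc' : Continuous fun t : ℝ =>
      Real.exp (-(Λ * t)) * N.stepMean Λ x (operatorExp (((T : ℝ) - t) • N.generator) f) :=
    (by fun_prop : Continuous fun t : ℝ => Real.exp (-(Λ * t))).mul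
      (N.continuous_stepMean Λ ((N.continuous_operatorExp f).comp (continuous_const.sub
        continuous_id)) x)
  have hexp : IntegrableOn (fun t : ℝ => Λ * Real.exp (-(Λ * t)) * f x) (Set.Ioi T) := by
    have := exp_neg_integrableOn_Ioi (T : ℝ) hΛ
    simp only [neg_mul] at this
    exact (this.const_mul Λ).mul_const _
  rw [setIntegral_waitingTime_Ioi hΛ hmeas, ← Set.Ioc_union_Ioi_eq_Ioi hs',
    setIntegral_union (Set.Ioc_disjoint_Ioi le_rfl) measurableSet_Ioi
      ((hc'.integrableOn_Ioc).congr_fun (fun t ht => (h1 t ht).symm) measurableSet_Ioc)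
      (hexp.congr_fun (fun t ht => (h2 t ht).symm) measurableSet_Ioi),
    setIntegral_congr_fun measurableSet_Ioc h1, setIntegral_congr_fun measurableSet_Ioi h2,
    ← setIntegral_waitingTime_Ioi hΛ measurable_const T, setIntegral_const,
    waitingTime_real_Ioi hΛ, ← intervalIntegral.integral_of_le hs', N.intervalIntegral_semigroup,
    semigroup, NNReal.coe_sub hs, smul_eq_mul, sub_add_cancel]

end Semigroup

/-! ### The Markov property of the uniformized chain -/

section Markov

variable {D : Type*} {V : Type u} [DecidableEq V] [Fintype D]

/-- The image under `π` of one step of the chain given by `φ` has the law of a jump, possibly void,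
of the load balancing process of `N`. -/
def IsUniformization (N : LBNetwork D V) (Λ : ℝ) {S : Type u} (φ : S → unitInterval → S)
    (π : S → N.State) : Prop :=
  ∀ (x : S) (f : N.State →ᵇ ℝ), ∫ a, f (π (φ x a)) = Λ⁻¹ * N.stepMean Λ (π x) f

/-- A functional of the path that is bounded by one and only depends on the path up to time `s`. -/
structure IsPastFunctional {S : Type u} [MeasurableSpace S] (s : ℝ≥0) (F : (ℝ≥0 → S) → ℝ) : Prop where
  measurable : Measurable F
  abs_le_one : ∀ p, |F p| ≤ 1
  congr : ∀ p p', (∀ r ≤ s, p r = p' r) → F p = F p'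

theorem IsPastFunctional.comp_gluePath {S : Type u} [MeasurableSpace S] {s : ℝ≥0}
    {F : (ℝ≥0 → S) → ℝ} (hF : IsPastFunctional s F)
    (x : S) (τ : ℝ≥0) : IsPastFunctional (s - τ) (F ∘ gluePath x τ) where
  measurable := hF.measurable.comp (measurable_gluePath x τ)
  abs_le_one p := hF.abs_le_one _
  congr p p' h := hF.congr _ _ fun r hr => by
    simp only [gluePath]
    split_ifs
    · rfl
    · exact h _ (tsub_le_tsub_right hr τ)

variable {N : LBNetwork D V} {Λ : ℝ} {S : Type u} {φ : S → unitInterval → S} {π : S → N.State}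
  [MeasurableSpace S] [Countable S] [DiscreteMeasurableSpace S]

theorem measurable_semigroup_noise (hφ : Measurable (Function.uncurry φ)) (f : N.State →ᵇ ℝ) (x : S)
    (T : ℝ≥0) : Measurable fun e : Noise =>
      if T < e.1 then f (π x) else N.semigroup (T - e.1) f (π (φ x e.2)) := by
  have hT : MeasurableSet {e : Noise | T < e.1} :=
    measurableSet_lt measurable_const measurable_fst
  refine Measurable.ite hT measurable_const ?_
  have h1 : Measurable fun q : ℝ≥0 × S => N.semigroup (T - q.1) f (π q.2) := by
    refine measurable_from_prod_countable_left fun y => ?_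
    have h2 : Continuous fun τ => N.semigroup (T - τ) f :=
      (N.continuous_semigroup f).comp (by fun_prop)
    exact ((BoundedContinuousFunction.evalCLM ℝ (π y)).continuous.comp h2).measurable
  have h2 : Measurable fun e : Noise => (e.1, φ x e.2) :=
    measurable_fst.prodMk (hφ.comp (measurable_const.prodMk measurable_snd))
  have h3 := h1.comp h2
  exact h3

theorem integrable_semigroup_noise (hΛ : 0 < Λ) (hφ : Measurable (Function.uncurry φ))
    (f : N.State →ᵇ ℝ) (x : S) (T : ℝ≥0) : Integrable (fun e : Noise =>
      if T < e.1 then f (π x) else N.semigroup (T - e.1) f (π (φ x e.2))) (noise Λ) := by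
  have := isProbabilityMeasure_noise hΛ
  obtain ⟨C, hC⟩ := N.exists_semigroup_le f T
  refine Integrable.of_bound (measurable_semigroup_noise hφ f x T).aestronglyMeasurable
    (max ‖f‖ C) (Eventually.of_forall fun e => ?_)
  split_ifs
  · exact (f.norm_coe_le_norm _).trans (le_max_left _ _)
  · exact ((BoundedContinuousFunction.norm_coe_le_norm _ _).trans
      (hC _ tsub_le_self)).trans (le_max_right _ _)

theorem IsUniformization.setIntegral_noise (h : IsUniformization N Λ φ π) (hΛ : 0 < Λ)
    (hφ : Measurable (Function.uncurry φ)) (f : N.State →ᵇ ℝ) (x : S) {s T : ℝ≥0} (hs : s ≤ T) :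
    ∫ e in Prod.fst ⁻¹' Set.Ioi s,
      (if T < e.1 then f (π x) else N.semigroup (T - e.1) f (π (φ x e.2))) ∂noise Λ =
      Real.exp (-(Λ * s)) * N.semigroup (T - s) f (π x) := by
  have := isProbabilityMeasure_waitingTime hΛ
  have hset : (Prod.fst ⁻¹' Set.Ioi s : Set Noise) = Set.Ioi s ×ˢ Set.univ := by ext; simp
  have hint := (integrable_semigroup_noise (π := π) hΛ hφ f x T).integrableOn
    (s := Set.Ioi s ×ˢ Set.univ)
  rw [noise] at hint
  rw [hset, noise, setIntegral_prod _ hint, ← N.setIntegral_waitingTime_semigroup hΛ f (π x) hs]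
  refine setIntegral_congr_fun measurableSet_Ioi fun τ _ => ?_
  dsimp only
  split_ifs
  · simp
  · rw [Measure.restrict_univ, h x]

theorem noise_ae_pos (hΛ : 0 < Λ) : ∀ᵐ e ∂noise Λ, 0 < e.1 := by
  have := isProbabilityMeasure_waitingTime hΛ
  exact Measure.quasiMeasurePreserving_fst.ae (waitingTime_ae_pos hΛ)

/-- The renewal equation of the semigroup. -/
theorem IsUniformization.integral_noise (h : IsUniformization N Λ φ π) (hΛ : 0 < Λ)
    (hφ : Measurable (Function.uncurry φ)) (f : N.State →ᵇ ℝ) (x : S) (T : ℝ≥0) :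
    ∫ e, (if T < e.1 then f (π x) else N.semigroup (T - e.1) f (π (φ x e.2))) ∂noise Λ =
      N.semigroup T f (π x) := by
  have h0 := h.setIntegral_noise hΛ hφ f x (zero_le : 0 ≤ T)
  rw [tsub_zero, NNReal.coe_zero, mul_zero, neg_zero, Real.exp_zero, one_mul,
    Measure.restrict_eq_self_of_ae_mem (s := Prod.fst ⁻¹' Set.Ioi (0 : ℝ≥0))
      (noise_ae_pos hΛ)] at h0
  exact h0

theorem noise_real_Iic_le (hΛ : 0 < Λ) {s s₀ : ℝ≥0} (hs : s ≤ s₀) :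
    (noise Λ).real (Prod.fst ⁻¹' Set.Iic s) ≤ 1 - Real.exp (-(Λ * s₀)) := by
  have := isProbabilityMeasure_noise hΛ
  rw [← waitingTime_real_Iic hΛ, ← noise_real_fst]
  exact measureReal_mono (Set.preimage_mono (Set.Iic_subset_Iic.2 hs))

/-- The uniformized chain has the transition semigroup of the load balancing process: both satisfy
the same renewal equation. -/
theorem IsUniformization.pathMean_eq_semigroup (h : IsUniformization N Λ φ π) (hΛ : 0 < Λ)
    (hφ : Measurable (Function.uncurry φ)) (f : N.State →ᵇ ℝ) (x : S) (t : ℝ≥0) :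
    pathMean φ Λ x (fun p => f (π (p t))) = N.semigroup t f (π x) := by
  have := isProbabilityMeasure_noise hΛ
  obtain ⟨C, hC⟩ := N.exists_semigroup_le f t
  have hf : ∀ r, ∀ p : ℝ≥0 → S, |f (π (p r))| ≤ ‖f‖ := fun r p => f.norm_coe_le_norm _
  have hfm : ∀ r, Measurable fun p : ℝ≥0 → S => f (π (p r)) := fun r =>
    (Measurable.of_discrete (f := fun y : S => f (π y))).comp (measurable_pi_apply r)
  let a : Set.Iic t × S → ℝ := fun q =>
    pathMean φ Λ q.2 (fun p => f (π (p q.1))) - N.semigroup q.1 f (π q.2)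
  have hpos := Real.exp_pos (-(Λ * t))
  have hle1 : Real.exp (-(Λ * t)) ≤ 1 := Real.exp_le_one_iff.2 (by
    have : 0 ≤ Λ * t := by positivity
    linarith)
  have key := eq_zero_of_contraction (a := a) (c := 1 - Real.exp (-(Λ * t))) (C := ‖f‖ + C)
    (by linarith) (by linarith) ?_ ?_ (⟨t, Set.mem_Iic.2 le_rfl⟩, x)
  · exact sub_eq_zero.1 key
  · rintro ⟨⟨r, hr⟩, y⟩
    refine (abs_sub _ _).trans (add_le_add (abs_pathMean_le hΛ y (hf r)) ?_)
    exact (BoundedContinuousFunction.norm_coe_le_norm _ _).trans (hC r hr)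
  · rintro B hB0 hB ⟨⟨r, hr⟩, y⟩
    obtain ⟨hi, he⟩ := pathMean_eq hΛ hφ y (hfm r) (hf r)
    have hi' := integrable_semigroup_noise (π := π) hΛ hφ f y r
    simp only [a]
    rw [he, ← h.integral_noise hΛ hφ f y r, ← integral_sub hi hi']
    have hbound : ∀ e : Noise, ‖pathMean φ Λ (φ y e.2) ((fun p => f (π (p r))) ∘ gluePath y e.1) -
        (if r < e.1 then f (π y) else N.semigroup (r - e.1) f (π (φ y e.2)))‖ ≤
        (Prod.fst ⁻¹' Set.Iic r).indicator (fun _ => B) e := fun e => by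
      by_cases hre : r < e.1
      · have hni : e ∉ (Prod.fst ⁻¹' Set.Iic r : Set Noise) := not_le.2 hre
        rw [Set.indicator_of_notMem hni, if_pos hre]
        have := isProbabilityMeasure_noiseSeq hΛ
        simp [pathMean, gluePath, hre]
      · have hin : e ∈ (Prod.fst ⁻¹' Set.Iic r : Set Noise) := not_lt.1 hre
        rw [Set.indicator_of_mem hin, if_neg hre]
        rw [Real.norm_eq_abs]
        have := hB (⟨r - e.1, Set.mem_Iic.2 (tsub_le_self.trans hr)⟩, φ y e.2)
        simpa only [a, Function.comp_def, gluePath, hre, if_false] using this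
    refine (norm_integral_le_of_norm_le ((integrable_const B).indicator
      (measurableSet_Iic.preimage measurable_fst)) (Eventually.of_forall hbound)).trans ?_
    rw [integral_indicator_const _ (measurableSet_Iic.preimage measurable_fst), smul_eq_mul]
    exact mul_le_mul_of_nonneg_right (noise_real_Iic_le hΛ hr) hB0

/-- The Markov property: the difference between the value of `f` at time `s + t` and its conditional
expectation `N.semigroup t f` is orthogonal to the past before `s`. A waiting time larger than `s`
contributes nothing by the renewal equation, and otherwise the chain starts afresh after the first
jump, with a shorter past. -/
theorem IsUniformization.pathMean_past_mul (h : IsUniformization N Λ φ π) (hΛ : 0 < Λ)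
    (hφ : Measurable (Function.uncurry φ)) (f : N.State →ᵇ ℝ) (x : S) (s t : ℝ≥0)
    {F : (ℝ≥0 → S) → ℝ} (hF : IsPastFunctional s F) :
    pathMean φ Λ x (fun p => F p * (f (π (p (s + t))) - N.semigroup t f (π (p s)))) = 0 := by
  have := isProbabilityMeasure_noise hΛ
  have := isProbabilityMeasure_noiseSeq hΛ
  set g := N.semigroup t f
  have hmeas : ∀ (k : N.State →ᵇ ℝ) (r : ℝ≥0), Measurable fun p : ℝ≥0 → S => k (π (p r)) :=
    fun k r => (Measurable.of_discrete (f := fun y : S => k (π y))).comp (measurable_pi_apply r)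
  have hΦm : ∀ (s : ℝ≥0) (F : (ℝ≥0 → S) → ℝ), IsPastFunctional s F →
      Measurable fun p => F p * (f (π (p (s + t))) - g (π (p s))) := fun s F hF =>
    hF.measurable.mul ((hmeas f _).sub (hmeas g _))
  have hΦb : ∀ (s : ℝ≥0) (F : (ℝ≥0 → S) → ℝ), IsPastFunctional s F →
      ∀ p, |F p * (f (π (p (s + t))) - g (π (p s)))| ≤ ‖f‖ + ‖g‖ := fun s F hF p => by
    rw [abs_mul]
    have h1 := hF.abs_le_one p
    have h2 : |f (π (p (s + t))) - g (π (p s))| ≤ ‖f‖ + ‖g‖ :=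
      (abs_sub _ _).trans (add_le_add (f.norm_coe_le_norm _) (g.norm_coe_le_norm _))
    exact (mul_le_mul h1 h2 (abs_nonneg _) zero_le_one).trans_eq (one_mul _)
  let ι : Type u := {q : ℝ≥0 × ((ℝ≥0 → S) → ℝ) × S // q.1 ≤ s ∧ IsPastFunctional q.1 q.2.1}
  let a : ι → ℝ := fun q => pathMean φ Λ q.1.2.2
    (fun p => q.1.2.1 p * (f (π (p (q.1.1 + t))) - g (π (p q.1.1))))
  have hpos := Real.exp_pos (-(Λ * s))
  have hle1 : Real.exp (-(Λ * s)) ≤ 1 := Real.exp_le_one_iff.2 (by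
    have : 0 ≤ Λ * s := by positivity
    linarith)
  refine eq_zero_of_contraction (a := a) (c := 1 - Real.exp (-(Λ * s))) (C := ‖f‖ + ‖g‖)
    (by linarith) (by linarith) (fun q => abs_pathMean_le hΛ _ (hΦb _ _ q.2.2)) ?_
    ⟨(s, F, x), le_rfl, hF⟩
  rintro B hB0 hB ⟨⟨r, G, y⟩, hr, hG⟩
  obtain ⟨hi, he⟩ := pathMean_eq hΛ hφ y (hΦm r G hG) (hΦb r G hG)
  simp only [a]
  have hA : MeasurableSet (Prod.fst ⁻¹' Set.Iic r : Set Noise) :=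
    measurableSet_Iic.preimage measurable_fst
  have hAc : (Prod.fst ⁻¹' Set.Iic r : Set Noise)ᶜ = Prod.fst ⁻¹' Set.Ioi r := by
    rw [← Set.preimage_compl, Set.compl_Iic]
  -- The waiting time is larger than `r`.
  have hlate : ∀ e ∈ (Prod.fst ⁻¹' Set.Ioi r : Set Noise),
      pathMean φ Λ (φ y e.2) ((fun p => G p * (f (π (p (r + t))) - g (π (p r)))) ∘
        gluePath y e.1) = G (fun _ => y) * ((if r + t < e.1 then f (π y) else
          N.semigroup (r + t - e.1) f (π (φ y e.2))) - g (π y)) := by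
    intro e hre
    have hre' : r < e.1 := hre
    have hG' : ∀ p, G (gluePath y e.1 p) = G fun _ => y := fun p => hG.congr _ _ fun r' hr' => by
      rw [gluePath, if_pos (hr'.trans_lt hre')]
    have h1 : ∀ p : ℝ≥0 → S, gluePath y e.1 p r = y := fun p => by rw [gluePath, if_pos hre']
    simp only [pathMean, Function.comp_def, hG', h1]
    rw [integral_const_mul, integral_sub _ (integrable_const _), integral_const]
    · congr 1
      rw [probReal_univ, one_smul]
      congr 1
      split_ifs with hc
      · simp [gluePath, hc]
      · simp only [gluePath, hc, if_false]
        exact h.pathMean_eq_semigroup hΛ hφ f (φ y e.2) (r + t - e.1)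
    · exact integrable_chainPath hΛ hφ (φ y e.2)
        (Φ := fun p => f (π (gluePath y e.1 p (r + t))))
        ((hmeas f (r + t)).comp (measurable_gluePath y e.1)) (fun p => f.norm_coe_le_norm _)
  have hlate0 : ∫ e in Prod.fst ⁻¹' Set.Ioi r,
      pathMean φ Λ (φ y e.2) ((fun p => G p * (f (π (p (r + t))) - g (π (p r)))) ∘
        gluePath y e.1) ∂noise Λ = 0 := by
    rw [setIntegral_congr_fun ((measurableSet_Ioi (a := r)).preimage measurable_fst) hlate,
      integral_const_mul, integral_sub
        (integrable_semigroup_noise (π := π) hΛ hφ f y (r + t)).integrableOn (integrable_const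
          (μ := (noise Λ).restrict (Prod.fst ⁻¹' Set.Ioi r)) (g (π y))),
      h.setIntegral_noise hΛ hφ f y le_self_add, setIntegral_const, noise_real_fst,
      waitingTime_real_Ioi hΛ, add_tsub_cancel_left, smul_eq_mul, sub_self, mul_zero]
  rw [he, ← integral_add_compl hA hi, hAc, hlate0, add_zero, ← Real.norm_eq_abs]
  refine (norm_setIntegral_le_of_norm_le_const (μ := noise Λ) (C := B) (measure_lt_top _ _)
    fun e hre => ?_).trans ?_
  · have hre' : ¬ r < e.1 := not_lt.2 hre
    have := hB ⟨(r - e.1, G ∘ gluePath y e.1, φ y e.2), tsub_le_self.trans hr,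
      hG.comp_gluePath y e.1⟩
    have h2 : ¬ r + t < e.1 := not_lt.2 (le_add_right hre)
    simp only [a] at this
    rw [Real.norm_eq_abs]
    simp only [Function.comp_def, gluePath, hre', h2, if_false] at this ⊢
    rwa [tsub_add_eq_add_tsub hre] at this
  · rw [mul_comm]
    exact mul_le_mul_of_nonneg_right (noise_real_Iic_le hΛ hr) hB0

end Markov

end LBNetwork

namespace LBNetwork

variable {D : Type*} {V : Type u} [DecidableEq V] [Fintype D]

/-! ### Uniqueness of the law of a load balancing process -/

section Uniqueness

variable {N : LBNetwork D V} {Ω Ω' : Type*} [MeasurableSpace Ω] [MeasurableSpace Ω']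
  {P : Measure Ω} {P' : Measure Ω'} [IsProbabilityMeasure P] [IsProbabilityMeasure P']
  {X : ℝ≥0 → Ω → N.State} {X' : ℝ≥0 → Ω' → N.State}

omit [Fintype D] in
theorem measurable_apply_state (f : N.State →ᵇ ℝ) : Measurable f := Measurable.of_discrete

/-- The information about the process up to time `s`. -/
abbrev pastSigma {Ω : Type*} (X : ℝ≥0 → Ω → N.State) (s : ℝ≥0) : MeasurableSpace Ω :=
  ⨆ r : Set.Iic s, MeasurableSpace.comap (X r) inferInstance

omit [Fintype D] in
theorem pastSigma_le (hX : ∀ t, Measurable (X t)) (s : ℝ≥0) :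
    pastSigma X s ≤ ‹MeasurableSpace Ω› :=
  iSup_le fun r => (hX r).comap_le

omit [Fintype D] [MeasurableSpace Ω] in
theorem measurable_pastSigma (X : ℝ≥0 → Ω → N.State) {r s : ℝ≥0} (hr : r ≤ s) :
    Measurable[pastSigma X s] (X r) :=
  measurable_iff_comap_le.2
    (le_iSup (fun r : Set.Iic s => MeasurableSpace.comap (X r) inferInstance) ⟨r, hr⟩)

theorem IsLoadBalancing.integral_prod_mul (hX : N.IsLoadBalancing P X) (J : Finset ℝ≥0) (s t : ℝ≥0)
    (hJ : ∀ j ∈ J, j ≤ s) (g : ℝ≥0 → N.State →ᵇ ℝ) (f : N.State →ᵇ ℝ) :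
    ∫ ω, (∏ j ∈ J, g j (X j ω)) * f (X (s + t) ω) ∂P =
      ∫ ω, (∏ j ∈ J, g j (X j ω)) * N.semigroup t f (X s ω) ∂P := by
  have hle := pastSigma_le hX.measurable s
  have hZm : Measurable[pastSigma X s] fun ω => ∏ j ∈ J, g j (X j ω) :=
    Finset.measurable_prod J fun j hj =>
      (measurable_apply_state (g j)).comp (measurable_pastSigma X (hJ j hj))
  have hZb : ∀ ω, ‖∏ j ∈ J, g j (X j ω)‖ ≤ ∏ j ∈ J, ‖g j‖ := fun ω => by
    rw [norm_prod]
    exact Finset.prod_le_prod (fun _ _ => norm_nonneg _) fun j _ => (g j).norm_coe_le_norm _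
  have hf : Integrable (fun ω => f (X (s + t) ω)) P :=
    Integrable.of_bound ((measurable_apply_state f).comp (hX.measurable _)).aestronglyMeasurable
      ‖f‖ (Eventually.of_forall fun ω => f.norm_coe_le_norm _)
  have hZf : Integrable ((fun ω => ∏ j ∈ J, g j (X j ω)) * fun ω => f (X (s + t) ω)) P :=
    hf.bdd_mul (hZm.mono hle le_rfl).aestronglyMeasurable (Eventually.of_forall hZb)
  have h := condExp_mul_of_stronglyMeasurable_left hZm.stronglyMeasurable hZf hf
  have h' : ∫ ω, (∏ j ∈ J, g j (X j ω)) * f (X (s + t) ω) ∂P = ∫ ω,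
      (P[(fun ω => ∏ j ∈ J, g j (X j ω)) * fun ω => f (X (s + t) ω) | pastSigma X s]) ω ∂P :=
    (integral_condExp hle).symm
  rw [h']
  refine integral_congr_ae ?_
  filter_upwards [h, hX.markov s t f] with ω h1 h2
  rw [h1, Pi.mul_apply, h2]

theorem IsLoadBalancing.integral_prod_eq (hX : N.IsLoadBalancing P X)
    (hX' : N.IsLoadBalancing P' X') (h0 : IdentDistrib (X 0) (X' 0) P P') (J : Finset ℝ≥0) :
    ∀ g : ℝ≥0 → N.State →ᵇ ℝ,
      ∫ ω, ∏ j ∈ J, g j (X j ω) ∂P = ∫ ω, ∏ j ∈ J, g j (X' j ω) ∂P' := by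
  classical
  induction J using Finset.induction_on_max with
  | empty => intro g; simp
  | insert m J hJ ih =>
    intro g
    have hm : m ∉ J := fun h => lt_irrefl _ (hJ m h)
    simp only [Finset.prod_insert hm, mul_comm (g m _)]
    rcases J.eq_empty_or_nonempty with rfl | hne
    · have h1 := hX.integral_prod_mul ∅ 0 m (by simp) g (g m)
      have h2 := hX'.integral_prod_mul ∅ 0 m (by simp) g (g m)
      rw [zero_add] at h1 h2
      rw [h1, h2]
      simp only [Finset.prod_empty, one_mul]
      exact (h0.comp (measurable_apply_state (N.semigroup m (g m)))).integral_eq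
    · -- The last factor is replaced by its conditional expectation given the previous time `s`.
      obtain ⟨hs, hmax⟩ : J.max' hne ∈ J ∧ ∀ j ∈ J, j ≤ J.max' hne :=
        ⟨J.max'_mem hne, fun j hj => J.le_max' j hj⟩
      set s := J.max' hne
      have hsm : s + (m - s) = m := add_tsub_cancel_of_le (hJ s hs).le
      have h1 := hX.integral_prod_mul J s (m - s) hmax g (g m)
      have h2 := hX'.integral_prod_mul J s (m - s) hmax g (g m)
      rw [hsm] at h1 h2
      rw [h1, h2]
      have h3 := ih (Function.update g s (g s * N.semigroup (m - s) (g m)))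
      have hcongr : ∀ z : ℝ≥0 → N.State,
          ∏ j ∈ J, Function.update g s (g s * N.semigroup (m - s) (g m)) j (z j) =
            (∏ j ∈ J, g j (z j)) * N.semigroup (m - s) (g m) (z s) := fun z => by
        rw [← Finset.mul_prod_erase J _ hs, ← Finset.mul_prod_erase J (fun j => g j (z j)) hs,
          Function.update_self, Finset.prod_congr rfl fun j hj => by
            rw [Function.update_of_ne (Finset.ne_of_mem_erase hj)]]
        simp only [BoundedContinuousFunction.coe_mul, Pi.mul_apply]
        ring
      rw [integral_congr_ae (Eventually.of_forall fun ω => hcongr fun j => X j ω),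
        integral_congr_ae (Eventually.of_forall fun ω => hcongr fun j => X' j ω)] at h3
      exact h3

omit [Fintype D] in
theorem measurable_process (hX : ∀ t, Measurable (X t)) : Measurable fun ω t => X t ω :=
  measurable_pi_lambda _ hX

/-- The initial distribution determines the law of a load balancing process. -/
theorem IsLoadBalancing.identDistrib (hX : N.IsLoadBalancing P X)
    (hX' : N.IsLoadBalancing P' X') (h0 : IdentDistrib (X 0) (X' 0) P P') :
    IdentDistrib (fun ω t => X t ω) (fun ω t => X' t ω) P P' := by
  classical
  have hXm := measurable_process hX.measurable
  have hXm' := measurable_process hX'.measurable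
  refine ⟨hXm.aemeasurable, hXm'.aemeasurable, ?_⟩
  have h := isProjectiveLimit_map (P := P) (X := X) hXm.aemeasurable
  have h' := isProjectiveLimit_map (P := P') (X := X') hXm'.aemeasurable
  suffices hI : ∀ I : Finset ℝ≥0, P.map (fun ω => I.restrict (X · ω)) =
      P'.map (fun ω => I.restrict (X' · ω)) by
    simp_rw [hI] at h
    exact h.unique h'
  intro I
  have hIm : Measurable fun ω => I.restrict (X · ω) := (Finset.measurable_restrict I).comp hXm
  have hIm' : Measurable fun ω => I.restrict (X' · ω) := (Finset.measurable_restrict I).comp hXm'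
  refine Measure.ext_of_singleton fun z => ?_
  rw [Measure.map_apply hIm (measurableSet_singleton z),
    Measure.map_apply hIm' (measurableSet_singleton z)]
  let g : ℝ≥0 → N.State →ᵇ ℝ := fun t =>
    BoundedContinuousFunction.ofNormedAddCommGroupDiscrete
      (fun y => if ∀ h : t ∈ I, y = z ⟨t, h⟩ then 1 else 0) 1 fun y => by split_ifs <;> simp
  have hg : ∀ p : ℝ≥0 → N.State, ∏ j ∈ I, g j (p j) =
      if I.restrict p = z then 1 else 0 := fun p => by
    simp only [g, BoundedContinuousFunction.coe_ofNormedAddCommGroupDiscrete]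
    rw [Finset.prod_ite_zero, Finset.prod_const_one]
    refine if_congr ?_ rfl rfl
    rw [funext_iff]
    exact ⟨fun h t => h t.1 t.2 t.2, fun h t ht _ => h ⟨t, ht⟩⟩
  have key := hX.integral_prod_eq hX' h0 I g
  have h1 : ∀ ω, ∏ j ∈ I, g j (X j ω) =
      ((fun ω => I.restrict (X · ω)) ⁻¹' {z}).indicator 1 ω := fun ω => by
    rw [hg (X · ω), Set.indicator_apply]
    exact if_congr Iff.rfl rfl rfl
  have h2 : ∀ ω, ∏ j ∈ I, g j (X' j ω) =
      ((fun ω => I.restrict (X' · ω)) ⁻¹' {z}).indicator 1 ω := fun ω => by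
    rw [hg (X' · ω), Set.indicator_apply]
    exact if_congr Iff.rfl rfl rfl
  simp only [h1, h2] at key
  rw [integral_indicator_one (hIm (measurableSet_singleton z)),
    integral_indicator_one (hIm' (measurableSet_singleton z))] at key
  exact (measureReal_eq_measureReal_iff).1 key

end Uniqueness

/-! ### Construction of load balancing processes -/

section Construction

variable {N : LBNetwork D V} {Λ : ℝ} {S : Type u} {φ : S → unitInterval → S} {π : S → N.State}
  [MeasurableSpace S] [Countable S] [DiscreteMeasurableSpace S]

theorem IsUniformization.isLoadBalancing (h : IsUniformization N Λ φ π) (hΛ : 0 < Λ)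
    (hφ : Measurable (Function.uncurry φ)) (m : Measure S) [IsProbabilityMeasure m] :
    N.IsLoadBalancing (m.prod (noiseSeq Λ)) (fun t p => π (chainPath φ p.1 p.2 t)) := by
  have := isProbabilityMeasure_noiseSeq hΛ
  have hπ : Measurable π := Measurable.of_discrete
  have hae : ∀ᵐ p ∂m.prod (noiseSeq Λ), NonExplosive p.2 :=
    Measure.quasiMeasurePreserving_snd.ae (ae_nonExplosive hΛ)
  let _ : TopologicalSpace S := ⊥
  have : DiscreteTopology S := ⟨rfl⟩
  have hπc : Continuous π := continuous_of_discreteTopology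
  have hYm : ∀ t, Measurable fun p : S × (ℕ → Noise) => π (chainPath φ p.1 p.2 t) := fun t =>
    hπ.comp (measurable_chainPath_apply hφ t)
  refine ⟨hYm, ?_, ?_, fun s t f => ?_⟩
  · filter_upwards [hae] with p hp t
    exact hπc.continuousAt.comp_continuousWithinAt (continuousWithinAt_chainPath φ hp p.1 t)
  · filter_upwards [hae] with p hp t
    obtain ⟨l, hl⟩ := exists_leftLimit_chainPath φ hp p.1 t
    exact ⟨π l, (hπc.tendsto l).comp hl⟩
  set Y : ℝ≥0 → S × (ℕ → Noise) → N.State := fun t p => π (chainPath φ p.1 p.2 t) with hY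
  have hle := pastSigma_le hYm s
  have hint : ∀ (k : N.State →ᵇ ℝ) (r : ℝ≥0),
      Integrable (fun p => k (Y r p)) (m.prod (noiseSeq Λ)) := fun k r =>
    Integrable.of_bound ((measurable_apply_state k).comp (hYm r)).aestronglyMeasurable
      ‖k‖ (Eventually.of_forall fun p => k.norm_coe_le_norm _)
  refine (ae_eq_condExp_of_forall_setIntegral_eq hle (hint f (s + t))
    (fun A _ _ => (hint _ s).integrableOn) (fun A hA _ => ?_) ?_).symm
  · -- `A` is the event that the path up to time `s` belongs to `B`.
    obtain ⟨B, hB, rfl⟩ : ∃ B : Set (Set.Iic s → N.State), MeasurableSet B ∧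
        (fun p (r : Set.Iic s) => Y r p) ⁻¹' B = A := by
      have hcomap : MeasurableSpace.comap (fun p (r : Set.Iic s) => Y r p)
          (⨆ r, MeasurableSpace.comap (fun q => q r) inferInstance) = pastSigma Y s := by
        rw [MeasurableSpace.comap_iSup]
        simp only [MeasurableSpace.comap_comp]
        rfl
      rw [← hcomap] at hA
      exact hA
    let F : (ℝ≥0 → S) → ℝ := fun p => B.indicator 1 fun r : Set.Iic s => π (p r)
    have hF : IsPastFunctional s F := by
      refine ⟨?_, fun p => ?_, fun p p' hp => ?_⟩
      · refine (measurable_const.indicator hB).comp (measurable_pi_lambda _ fun r => ?_)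
        exact hπ.comp (measurable_pi_apply _)
      · by_cases hp : (fun r : Set.Iic s => π (p r)) ∈ B <;> simp [F, hp]
      · simp only [F]
        congr 1
        funext r
        rw [hp r r.2]
    have hAm : MeasurableSet ((fun p (r : Set.Iic s) => Y r p) ⁻¹' B) :=
      (measurable_pi_lambda _ fun r : Set.Iic s => hYm r) hB
    rw [eq_comm, ← sub_eq_zero, ← integral_sub (hint f _).integrableOn (hint _ s).integrableOn,
      ← integral_indicator hAm]
    have hind : ∀ p, ((fun p (r : Set.Iic s) => Y r p) ⁻¹' B).indicator
        (fun p => f (Y (s + t) p) - N.semigroup t f (Y s p)) p =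
        (fun q : ℝ≥0 → S => F q * (f (π (q (s + t))) - N.semigroup t f (π (q s))))
          (chainPath φ p.1 p.2) := fun p => by
      by_cases hp : (fun r : Set.Iic s => π (chainPath φ p.1 p.2 r)) ∈ B
      · rw [Set.indicator_of_mem (show p ∈ (fun p (r : Set.Iic s) => Y r p) ⁻¹' B from hp)]
        simp [F, hp, hY]
      · rw [Set.indicator_of_notMem (show p ∉ (fun p (r : Set.Iic s) => Y r p) ⁻¹' B from hp)]
        simp [F, hp]
    have hi := (((hint f (s + t)).sub (hint (N.semigroup t f) s)).indicator hAm)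
    have hi' := hi.congr (Eventually.of_forall hind)
    rw [integral_congr_ae (Eventually.of_forall hind), integral_prod _ hi']
    exact (integral_congr_ae (Eventually.of_forall fun x =>
      h.pathMean_past_mul hΛ hφ f x s t hF)).trans (integral_zero _ _)
  · exact ((measurable_apply_state (N.semigroup t f)).comp
      (measurable_pastSigma Y le_rfl)).stronglyMeasurable.aestronglyMeasurable

omit [Countable S] [DiscreteMeasurableSpace S] in
theorem ae_chainPath_zero (hΛ : 0 < Λ) (φ : S → unitInterval → S) (m : Measure S)
    [IsProbabilityMeasure m] : ∀ᵐ p ∂m.prod (noiseSeq Λ), chainPath φ p.1 p.2 0 = p.1 := by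
  have := isProbabilityMeasure_noise hΛ
  have := isProbabilityMeasure_noiseSeq hΛ
  have h1 : ∀ᵐ ω ∂noiseSeq Λ, 0 < (ω 0).1 :=
    (measurePreserving_eval_infinitePi (fun _ : ℕ => noise Λ) 0).quasiMeasurePreserving.ae
      (noise_ae_pos hΛ)
  filter_upwards [Measure.quasiMeasurePreserving_snd.ae h1] with p hp
  have : jumpCount p.2 0 = 0 := by
    refine Nat.sInf_eq_zero.2 (Or.inl ?_)
    simpa [jumpTime] using hp
  rw [chainPath, this]
  rfl

end Construction

/-! ### Coupling of load balancing processes -/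

section Coupling

variable {N₁ N₂ : LBNetwork D V} {T : N₁.State → N₂.State → Prop}

theorem stepMean_one (N : LBNetwork D V) (Λ : ℝ) (x : N.State) : N.stepMean Λ x 1 = Λ := by
  simp [stepMean, drift]

/-- A coupling of the jumps that maintains `T` is realized by a random map of the set of pairs of
states that are related by `T`. -/
theorem exists_isUniformization {Λ : ℝ} (hΛ : 0 < Λ)
    (hT : ∀ x y, T x y → Coupled T (N₁.stepMean Λ x) (N₂.stepMean Λ y))
    [Nonempty {p : N₁.State × N₂.State // T p.1 p.2}] :
    ∃ φ : {p : N₁.State × N₂.State // T p.1 p.2} → unitInterval →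
        {p : N₁.State × N₂.State // T p.1 p.2}, Measurable (Function.uncurry φ) ∧
      IsUniformization N₁ Λ φ (fun p => p.1.1) ∧ IsUniformization N₂ Λ φ (fun p => p.1.2) := by
  classical
  let S := {p : N₁.State × N₂.State // T p.1 p.2}
  choose γ hγ h1 h2 using fun p : S => hT p.1.1 p.1.2 p.2
  let κ : S → Measure S := fun p =>
    ∑ q ∈ (γ p).support.attach, ENNReal.ofReal (Λ⁻¹ * γ p q.1) • Measure.dirac ⟨q.1, hγ p _ q.2⟩
  have hκ : ∀ p, ∀ k : S → ℝ, ∫ q, k q ∂κ p =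
      Λ⁻¹ * ∑ q ∈ (γ p).support.attach, γ p q.1 * k ⟨q.1, hγ p _ q.2⟩ := fun p k => by
    have hi : ∀ q ∈ (γ p).support.attach, Integrable k
        (ENNReal.ofReal (Λ⁻¹ * γ p q.1) • Measure.dirac ⟨q.1, hγ p _ q.2⟩) := fun q _ =>
      (integrable_dirac (by simp)).smul_measure ENNReal.ofReal_ne_top
    rw [integral_finsetSum_measure hi, Finset.mul_sum]
    refine Finset.sum_congr rfl fun q _ => ?_
    rw [integral_smul_measure, integral_dirac, ENNReal.toReal_ofReal (by positivity), smul_eq_mul,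
      mul_assoc]
  have hprob : ∀ p, IsProbabilityMeasure (κ p) := fun p => by
    have h := h1 p 1
    rw [stepMean_one, Finsupp.sum, ← Finset.sum_attach] at h
    have hsum : ∑ q ∈ (γ p).support.attach, Λ⁻¹ * (γ p q.1 : ℝ) = 1 := by
      rw [← Finset.mul_sum, inv_mul_eq_one₀ hΛ.ne']
      simpa using h
    refine ⟨?_⟩
    simp only [κ, Measure.coe_finsetSum, Finset.sum_apply, Measure.smul_apply, measure_univ,
      smul_eq_mul, mul_one]
    rw [← ENNReal.ofReal_sum_of_nonneg fun q _ => by positivity, hsum, ENNReal.ofReal_one]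
  let K : Kernel S S := ⟨κ, Measurable.of_discrete⟩
  have : IsMarkovKernel K := ⟨hprob⟩
  obtain ⟨φ, hφ, hφK⟩ := K.exists_measurable_map_eq_unitInterval
  have hint : ∀ (p : S) (k : S → ℝ), ∫ a, k (φ p a) = ∫ q, k q ∂κ p := fun p k => by
    have : κ p = volume.map (φ p) := (hφK p).symm
    have hφp : Measurable (φ p) := hφ.comp measurable_prodMk_left
    rw [this, integral_map hφp.aemeasurable
      (Measurable.of_discrete).aestronglyMeasurable]
  refine ⟨φ, hφ, fun p f => ?_, fun p f => ?_⟩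
  · rw [hint p fun q => f q.1.1, hκ, h1 p f, Finsupp.sum, ← Finset.sum_attach (γ p).support]
  · rw [hint p fun q => f q.1.2, hκ, h2 p f, Finsupp.sum, ← Finset.sum_attach (γ p).support]

/-- A simulation that contains the initial states leads to a coupling of the processes. -/
theorem IsSimulation.existsCoupling (hT : IsSimulation N₁ N₂ T) {Ω₁ Ω₂ : Type*}
    [MeasurableSpace Ω₁] [MeasurableSpace Ω₂] {P₁ : Measure Ω₁} {P₂ : Measure Ω₂}
    [IsProbabilityMeasure P₁] [IsProbabilityMeasure P₂] {X₁ : ℝ≥0 → Ω₁ → N₁.State}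
    {X₂ : ℝ≥0 → Ω₂ → N₂.State} (hX₁ : N₁.IsLoadBalancing P₁ X₁) (hX₂ : N₂.IsLoadBalancing P₂ X₂)
    (hS : N₁.servers ⊆ N₂.servers)
    (h0 : IdentDistrib (X₁ 0) (fun ω => restrictState hS (X₂ 0 ω)) P₁ P₂)
    (hT0 : ∀ᵐ ω ∂P₂, T (restrictState hS (X₂ 0 ω)) (X₂ 0 ω)) :
    ExistsCoupling N₁ N₂ P₁ P₂ X₁ X₂ T := by
  classical
  obtain ⟨Λ₀, hsim⟩ := hT
  have hΛ : 0 < max Λ₀ 1 := lt_max_of_lt_right one_pos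
  set Λ := max Λ₀ 1
  let S := {p : N₁.State × N₂.State // T p.1 p.2}
  obtain ⟨ω₀, hω₀⟩ := hT0.exists
  let p₀ : S := ⟨(restrictState hS (X₂ 0 ω₀), X₂ 0 ω₀), hω₀⟩
  have : Nonempty S := ⟨p₀⟩
  obtain ⟨φ, hφ, hφ₁, hφ₂⟩ := exists_isUniformization hΛ (hsim Λ (le_max_left _ _))
  let j : N₂.State → S := fun y =>
    if h : T (restrictState hS y) y then ⟨(restrictState hS y, y), h⟩ else p₀
  have hj : Measurable j := Measurable.of_discrete
  have hjX : Measurable fun ω => j (X₂ 0 ω) := hj.comp (hX₂.measurable 0)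
  let m : Measure S := P₂.map fun ω => j (X₂ 0 ω)
  have : IsProbabilityMeasure m := Measure.isProbabilityMeasure_map hjX.aemeasurable
  have := isProbabilityMeasure_noiseSeq hΛ
  have hY₁ := hφ₁.isLoadBalancing hΛ hφ m
  have hY₂ := hφ₂.isLoadBalancing hΛ hφ m
  -- The law of a function of the initial state.
  have hinit : ∀ {Z : Type u} [MeasurableSpace Z] (k : S → Z), Measurable k →
      IdentDistrib (fun p : S × (ℕ → Noise) => k (chainPath φ p.1 p.2 0))
        (fun ω => k (j (X₂ 0 ω))) (m.prod (noiseSeq Λ)) P₂ := fun k hk => by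
    refine ⟨(hk.comp (measurable_chainPath_apply hφ 0)).aemeasurable,
      (hk.comp hjX).aemeasurable, ?_⟩
    have hae : (fun p : S × (ℕ → Noise) => k (chainPath φ p.1 p.2 0)) =ᵐ[m.prod (noiseSeq Λ)]
        k ∘ Prod.fst := by
      filter_upwards [ae_chainPath_zero hΛ φ m] with p hp
      rw [hp]
      rfl
    rw [Measure.map_congr hae, ← Measure.map_map hk measurable_fst, Measure.map_fst_prod,
      measure_univ, one_smul, Measure.map_map hk hjX]
    rfl
  refine ⟨S × (ℕ → Noise), inferInstance, m.prod (noiseSeq Λ), inferInstance,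
    fun t p => (chainPath φ p.1 p.2 t).1.1, fun t p => (chainPath φ p.1 p.2 t).1.2, hY₁, hY₂,
    hY₁.identDistrib hX₁ ?_, hY₂.identDistrib hX₂ ?_,
    Eventually.of_forall fun p t => (chainPath φ p.1 p.2 t).2⟩
  · refine (hinit (fun q => q.1.1) Measurable.of_discrete).trans (IdentDistrib.trans ?_ h0.symm)
    refine IdentDistrib.of_ae_eq
      ((Measurable.of_discrete (f := fun q : S => q.1.1)).comp hjX).aemeasurable ?_
    filter_upwards [hT0] with ω hω
    simp only [j, dif_pos hω]
  · refine (hinit (fun q => q.1.2) Measurable.of_discrete).trans ?_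
    refine IdentDistrib.of_ae_eq
      ((Measurable.of_discrete (f := fun q : S => q.1.2)).comp hjX).aemeasurable ?_
    filter_upwards [hT0] with ω hω
    simp only [j, dif_pos hω]

theorem ExistsCoupling.mono {Ω₁ Ω₂ : Type*} [MeasurableSpace Ω₁] [MeasurableSpace Ω₂]
    {P₁ : Measure Ω₁} {P₂ : Measure Ω₂} {X₁ : ℝ≥0 → Ω₁ → N₁.State} {X₂ : ℝ≥0 → Ω₂ → N₂.State}
    {R : N₁.State → N₂.State → Prop} (h : ExistsCoupling N₁ N₂ P₁ P₂ X₁ X₂ T)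
    (hR : ∀ x y, T x y → R x y) : ExistsCoupling N₁ N₂ P₁ P₂ X₁ X₂ R := by
  obtain ⟨Ω, mΩ, Q, hQ, Y₁, Y₂, h1, h2, h3, h4, h5⟩ := h
  exact ⟨Ω, mΩ, Q, hQ, Y₁, Y₂, h1, h2, h3, h4, h5.mono fun ω hω t => hR _ _ (hω t)⟩

/-- A coupling gives the stochastic order of the coordinates that are ordered by the coupling. -/
theorem ExistsCoupling.measure_le {Ω₁ Ω₂ : Type*} [MeasurableSpace Ω₁] [MeasurableSpace Ω₂]
    {P₁ : Measure Ω₁} {P₂ : Measure Ω₂} {X₁ : ℝ≥0 → Ω₁ → N₁.State} {X₂ : ℝ≥0 → Ω₂ → N₂.State}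
    (h : ExistsCoupling N₁ N₂ P₁ P₂ X₁ X₂ T) {w₁ : N₁.servers} {w₂ : N₂.servers}
    (hw : ∀ x y, T x y → y w₂ ≤ x w₁) (t : ℝ≥0) (k : ℕ) :
    P₂ {ω | k ≤ X₂ t ω w₂} ≤ P₁ {ω | k ≤ X₁ t ω w₁} := by
  obtain ⟨Ω, mΩ, Q, hQ, Y₁, Y₂, -, -, h1, h2, h3⟩ := h
  have hA : ∀ {N : LBNetwork D V} (w : N.servers),
      MeasurableSet {p : ℝ≥0 → N.State | k ≤ p t w} := fun w =>
    measurableSet_le measurable_const ((measurable_pi_apply w).comp (measurable_pi_apply t))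
  have e1 := h1.measure_mem_eq (hA w₁)
  have e2 := h2.measure_mem_eq (hA w₂)
  have hle : Q {ω | k ≤ Y₂ t ω w₂} ≤ Q {ω | k ≤ Y₁ t ω w₁} :=
    measure_mono_ae (h3.mono fun ω hω hk => le_trans hk (hw _ _ (hω t)))
  exact (e2.symm.trans_le hle).trans_eq e1

end Coupling

end LBNetwork

theorem mainTheorem5 {D : Type*} [Fintype D] {V : Type u} [DecidableEq V]
    (N₁ N₂ : LBNetwork D V)
    {Ω₁ Ω₂ : Type*} [MeasurableSpace Ω₁] [MeasurableSpace Ω₂]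
    (P₁ : Measure Ω₁) (P₂ : Measure Ω₂) [IsProbabilityMeasure P₁] [IsProbabilityMeasure P₂]
    (X₁ : ℝ≥0 → Ω₁ → N₁.State) (X₂ : ℝ≥0 → Ω₂ → N₂.State)
    (hX₁ : N₁.IsLoadBalancing P₁ X₁) (hX₂ : N₂.IsLoadBalancing P₂ X₂) :
    -- edge simplification
    (∀ (d : D) (u v : V) (h : LBNetwork.EdgeSimplification N₁ N₂ d u v),
      IdentDistrib (X₁ 0) (fun ω (w : N₁.servers) => X₂ 0 ω ⟨w, h.subset w.2⟩) P₁ P₂ →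
      (∀ᵐ ω ∂P₂, X₂ 0 ω ⟨v, h.new_mem_servers⟩ ≤ X₂ 0 ω ⟨u, h.subset h.mem_servers⟩) →
      (∀ (t : ℝ≥0) (k : ℕ),
        P₂ {ω | k ≤ X₂ t ω ⟨v, h.new_mem_servers⟩} ≤ P₁ {ω | k ≤ X₁ t ω ⟨u, h.mem_servers⟩}) ∧
      (∀ (t : ℝ≥0) (w : N₁.servers) (k : ℕ),
        P₂ {ω | k ≤ X₂ t ω ⟨w, h.subset w.2⟩} ≤ P₁ {ω | k ≤ X₁ t ω w}) ∧
      LBNetwork.ExistsCoupling N₁ N₂ P₁ P₂ X₁ X₂ (fun x₁ x₂ =>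
        x₂ ⟨v, h.new_mem_servers⟩ ≤ x₁ ⟨u, h.mem_servers⟩ ∧
          ∀ w : N₁.servers, x₂ ⟨w, h.subset w.2⟩ ≤ x₁ w)) ∧
    -- arrival rate decrease, service rate increase, server addition
    (∀ h : LBNetwork.SimpleTransformation N₁ N₂,
      IdentDistrib (X₁ 0) (fun ω (w : N₁.servers) => X₂ 0 ω ⟨w, h.subset w.2⟩) P₁ P₂ →
      (∀ (t : ℝ≥0) (w : N₁.servers) (k : ℕ),
        P₂ {ω | k ≤ X₂ t ω ⟨w, h.subset w.2⟩} ≤ P₁ {ω | k ≤ X₁ t ω w}) ∧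
      LBNetwork.ExistsCoupling N₁ N₂ P₁ P₂ X₁ X₂ (fun x₁ x₂ =>
        ∀ w : N₁.servers, x₂ ⟨w, h.subset w.2⟩ ≤ x₁ w)) ∧
    -- finite compositions
    (∀ h : LBNetwork.FiniteComposition N₁ N₂,
      IdentDistrib (X₁ 0) (fun ω (w : N₁.servers) => X₂ 0 ω ⟨w, h.subset w.2⟩) P₁ P₂ →
      (∀ᵐ ω ∂P₂, ∀ w : N₂.servers, (w : V) ∉ N₁.servers → X₂ 0 ω w = 0) →
      (∀ (t : ℝ≥0) (w : N₁.servers) (k : ℕ),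
        P₂ {ω | k ≤ X₂ t ω ⟨w, h.subset w.2⟩} ≤ P₁ {ω | k ≤ X₁ t ω w}) ∧
      LBNetwork.ExistsCoupling N₁ N₂ P₁ P₂ X₁ X₂ (fun x₁ x₂ =>
        ∀ w : N₁.servers, x₂ ⟨w, h.subset w.2⟩ ≤ x₁ w)) := by
  refine ⟨fun d u v h h0 huv => ?_, fun h h0 => ?_, fun h h0 hz => ?_⟩
  · have hc := h.dominates.isSimulation.existsCoupling hX₁ hX₂ h.subset h0
      (huv.mono fun ω hω => LBNetwork.dom_sameServerOr_restrictState h.subset hω)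
    exact ⟨fun t k => hc.measure_le (fun x y hxy => hxy _ _ (Or.inr ⟨rfl, rfl⟩)) t k,
      fun t w k => hc.measure_le (fun x y hxy => hxy _ _ (Or.inl rfl)) t k,
      hc.mono fun x y hxy => ⟨hxy _ _ (Or.inr ⟨rfl, rfl⟩), fun w => hxy _ _ (Or.inl rfl)⟩⟩
  · have hc := h.dominates.isSimulation.existsCoupling hX₁ hX₂ h.subset h0
      (Eventually.of_forall fun ω => LBNetwork.dom_sameServer_restrictState h.subset _)
    exact ⟨fun t w k => hc.measure_le (fun x y hxy => hxy w ⟨w, h.subset w.2⟩ rfl) t k,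
      hc.mono fun x y hxy w => hxy w ⟨w, h.subset w.2⟩ rfl⟩
  · obtain ⟨hS, T, hsim, hle, hT⟩ := h.exists_isSimulation
    have hc := hsim.existsCoupling hX₁ hX₂ hS h0 (hz.mono fun ω hω => hT _ hω)
    exact ⟨fun t w k => hc.measure_le (fun x y hxy => hle x y hxy w) t k,
      hc.mono fun x y hxy w => hle x y hxy w⟩
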